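/- **Setting.** Let $d\ge 1$, $\mathfrak L=\mathbb Z^d$ with Euclidean length $|\cdot|$, and $\Lambda_L=\{x\in\mathfrak L:|x_1|,\dots,|x_d|\le L\}$ for $L\ge 0$. Let $\mathcal U$ be the CAR $C^*$-algebra of $\mathfrak L$, generated by a unit and elements $a_x$, $x\in\mathfrak L$, with $a_xa_y+a_ya_x=0$ and $a_xa_y^*+a_y^*a_x=\delta_{x,y}\mathbf 1$. For finite $\Lambda\subset\mathfrak L$ let $\mathcal U_\Lambda$ be the $*$-subalgebra generated by $\mathbf 1$ and $a_x$, $x\in\Lambda$. Let $\mathcal U^+$ be the set of even elements, that is, the fixed points of the $*$-automorphism with $a_x\mapsto -a_x$, and let $\chi_x$ be the $*$-automorphism with $\chi_x(a_y)=a_{y+x}$. Let $\mathbf F:[0,\infty)\to(0,\infty)$ be non-increasing with $\sum_{x\in\mathfrak L}\mathbf F(|x|)<\infty$ and $$\mathbf D=\sup_{x,y\in\mathfrak L}\sum_{z\in\mathfrak L}\frac{\mathbf F(|x-z|)\,\mathbf F(|z-y|)}{\mathbf F(|x-y|)}<\infty .$$ An interaction is a family $\Phi=\{\Phi_\Lambda\}$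 of self-adjoint elements $\Phi_\Lambda\in\mathcal U^+\cap\mathcal U_\Lambda$, indexed by the finite subsets of $\mathfrak L$, with $\Phi_\emptyset=0$; $\mathcal W$ is the space of interactions with $$\|\Phi\|_{\mathcal W}=\sup_{x,y\in\mathfrak L}\ \sum_{\Lambda\supset\{x,y\}}\frac{\|\Phi_\Lambda\|}{\mathbf F(|x-y|)}<\infty .$$ A potential is a family of self-adjoint elements $\mathbf V_{\{x\}}\in\mathcal U^+\cap\mathcal U_{\{x\}}$, $x\in\mathfrak L$ (not necessarily bounded in $x$). **Dynamics.** Let $\Psi=\{\Psi^{(t)}\}_{t\in\mathbb R}\subset\mathcal W$ with $\|\Psi\|_\infty=\sup_{t}\|\Psi^{(t)}\|_{\mathcal W}<\infty$, and let $\{\mathbf V^{(t)}\}_{t\in\mathbb R}$ be potentials. Assume that $t\mapsto\Psi^{(t)}_\Lambda$ and $t\mapsto\mathbf V^{(t)}_{\{y\}}$ are norm continuous for each finite $\Lambda\subset\mathfrak L$ and each $y\in\mathfrak L$. Put $$\delta^{(L)}_t(B)=i\sum_{\Lambda\subseteq\Lambda_L}[\Psi^{(t)}_\Lambda,B]+i\sum_{x\in\Lambda_L}[\mathbf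 V^{(t)}_{\{x\}},B],$$ and let $\tau^{(L)}_{t,s}$ be the solution of $\partial_t\tau^{(L)}_{t,s}=\tau^{(L)}_{t,s}\circ\delta_t^{(L)}$, $\partial_s\tau^{(L)}_{t,s}=-\delta_s^{(L)}\circ\tau^{(L)}_{t,s}$, $\tau^{(L)}_{s,s}=\mathbf 1$, in the bounded operators on $\mathcal U$. Let $\tau_{t,s}$ be the strong limit of $\tau^{(L)}_{t,s}$ as $L\to\infty$. **Notation for the bound.** Multi-commutators are $[B_1,B_0]^{(2)}=B_1B_0-B_0B_1$ and $[B_k,\dots,B_0]^{(k+1)}=[B_k,[B_{k-1},\dots,B_0]^{(k)}]$. Let $\mathcal T_2=\{\{\{0,1\}\}\}$ and $\mathcal T_{k+1}=\{\{\{j,k\}\}\cup T:0\le j\le k-1,\ T\in\mathcal T_k\}$ for $k\ge2$; for $T\in\mathcal T_{k+1}$ and $1\le j\le k$ let $P_T(j)$ be the unique $i<j$ with $\{i,j\}\in T$. For $n_0,\dots,n_k\in\mathbb N_0$ and $x_0,\dots,x_k\in\mathfrak L$ set $$\varkappa_T(\{(n_j,x_j)\}_{j=0}^k)=\prod_{j=1}^k\mathbf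 1\big[(\Lambda_{n_j}+x_j)\cap(\Lambda_{n_{P_T(j)}}+x_{P_T(j)})\ne\emptyset\big].$$ Let $\mathcal S_{\ell,k}$ be the set of strictly increasing maps $\pi:\{\ell,\dots,k\}\to\{1,\dots,k\}$, and write $J_\pi=\{\pi(\ell),\dots,\pi(k)\}$. For $\alpha\ge0$ and times $t_1,\dots,t_k$ set $$\Re_{T,\alpha}=\sum_{\ell=1}^k(2\alpha)^{k-\ell+1}\sum_{\pi\in\mathcal S_{\ell,k}}\Big(\prod_{j\in J_\pi}|t_j|e^{4\mathbf D\alpha|t_j|}\Big)\sum_{(n_j)_{j\in J_\pi}:\,n_j\ge m_j+1}\ \sum_{(z_j):\,z_j\in\Lambda_{m_j}}\ \sum_{(y_j):\,y_j\in\Lambda_{n_j}\setminus\Lambda_{n_j-1}}\varkappa_T(\{(n_j,x_j)\}_{j=0}^k)\prod_{j\in J_\pi}\mathbf F(|z_j-y_j|),$$ where $n_j=m_j$ for $j\in\{0,\dots,k\}\setminus J_\pi$. **Theorem (Lieb–Robinson bounds for multi-commutators, non-autonomous case).** Under these assumptions the infinite-volume dynamics $\tau_{t,s}$ exists, and for all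 $s\in\mathbb R$, all integers $k\ge1$, all $m_0,\dots,m_k\in\mathbb N_0$, $s_1,\dots,s_k\in\mathbb R$, $x_0,\dots,x_k\in\mathfrak L$, and all $B_0\in\mathcal U_{\Lambda_{m_0}}$ and $B_j\in\mathcal U_{\Lambda_{m_j}}\cap\mathcal U^+$, $1\le j\le k$, $$\Big\|\big[\tau_{s_k,s}\circ\chi_{x_k}(B_k),\dots,\tau_{s_1,s}\circ\chi_{x_1}(B_1),\chi_{x_0}(B_0)\big]^{(k+1)}\Big\|\le 2^k\prod_{j=0}^k\|B_j\|\sum_{T\in\mathcal T_{k+1}}\Big(\varkappa_T(\{(m_j,x_j)\}_{j=0}^k)+\Re_{T,\|\Psi\|_\infty}\Big),$$ with $\Re_{T,\alpha}$ taken at the times $t_j=s_j-s$. -/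

import Mathlib

open scoped NNReal ENNReal

noncomputable section

namespace FermiLattice

/-! ### The lattice `ℤ^d`, cubic boxes, and the Euclidean length -/

/-- The lattice `𝔏 = ℤ^d`. -/
abbrev Lattice (d : ℕ) : Type := Fin d → ℤ

/-- The cubic box `Λ_L = {x : |x_i| ≤ L for all i}`, see `mem_box`. -/
def box {d : ℕ} (L : ℝ) : Finset (Lattice d) :=
  Fintype.piFinset fun _ => Finset.Icc (-⌊L⌋) ⌊L⌋

theorem mem_box {d : ℕ} (L : ℝ) (x : Lattice d) : x ∈ box L ↔ ∀ i, |(x i : ℝ)| ≤ L := by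
  simp only [box, Fintype.mem_piFinset, Finset.mem_Icc]
  refine forall_congr' fun i => ?_
  rw [abs_le, Int.le_floor, neg_le, Int.le_floor, neg_le]
  push_cast
  rw [neg_le]

/-- The translated box `Λ_L + x`. -/
def boxAt {d : ℕ} (L : ℝ) (x : Lattice d) : Finset (Lattice d) :=
  (box L).image fun y => y + x

/-- The Euclidean length `|x|` of a lattice vector. -/
def len {d : ℕ} (x : Lattice d) : ℝ≥0 :=
  ‖(WithLp.toLp 2 fun i => (x i : ℝ) : EuclideanSpace ℝ (Fin d))‖₊

/-! ### The fermion Fock space in occupation-number form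

The antisymmetric Fock space over `ℓ²(ℤ^d)` has an orthonormal basis `e_S` indexed by the finite
sets `S` of occupied sites (fix a total order of the sites and take
`e_S = a*_{x₁} ⋯ a*_{xₙ} Ω` for `S = {x₁ < ⋯ < xₙ}`). It is therefore `ℓ²` of these sets. -/

/-- The fermion Fock space over `ℓ²(ℤ^d)`. -/
abbrev Fock (d : ℕ) : Type := lp (fun _ : Finset (Lattice d) => ℂ) 2

/-- The bounded operator `(T ψ)(S) = c(S) ψ(e S)`, with `|c| ≤ 1` and `e` a bijection. -/
def weightedPerm {d : ℕ} (c : Finset (Lattice d) → ℂ) (e : Equiv.Perm (Finset (Lattice d)))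
    (hc : ∀ S, ‖c S‖ ≤ 1) : Fock d →L[ℂ] Fock d :=
  have h2 : (0 : ℝ) < (2 : ℝ≥0∞).toReal := by norm_num
  have hle : ∀ (ψ : Fock d) (S : Finset (Lattice d)),
      ‖c S * ψ (e S)‖ ^ (2 : ℝ≥0∞).toReal ≤ ‖ψ (e S)‖ ^ (2 : ℝ≥0∞).toReal := fun ψ S => by
    refine Real.rpow_le_rpow (norm_nonneg _) ?_ h2.le
    rw [norm_mul]
    exact mul_le_of_le_one_left (norm_nonneg _) (hc S)
  have hsum : ∀ ψ : Fock d, Summable fun S => ‖ψ (e S)‖ ^ (2 : ℝ≥0∞).toReal := fun ψ =>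
    (Equiv.summable_iff e (f := fun S => ‖ψ S‖ ^ (2 : ℝ≥0∞).toReal)).2
      ((memℓp_gen_iff h2).1 (lp.memℓp ψ))
  have hmem : ∀ ψ : Fock d,
      Memℓp (E := fun _ : Finset (Lattice d) => ℂ) (fun S => c S * ψ (e S)) 2 := fun ψ =>
    (memℓp_gen_iff h2).2 (Summable.of_nonneg_of_le
      (fun S => Real.rpow_nonneg (norm_nonneg _) _) (hle ψ) (hsum ψ))
  LinearMap.mkContinuous
    { toFun := fun ψ => (⟨fun S => c S * ψ (e S), hmem ψ⟩ : Fock d)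
      map_add' := fun ψ φ => by
        ext S
        exact mul_add (c S) (ψ (e S)) (φ (e S))
      map_smul' := fun r ψ => by
        ext S
        simp [mul_left_comm] } 1 (fun ψ => by
      rw [one_mul]
      refine (Real.rpow_le_rpow_iff (norm_nonneg _) (norm_nonneg _) h2).1 ?_
      rw [lp.norm_rpow_eq_tsum h2, lp.norm_rpow_eq_tsum h2,
        ← Equiv.tsum_eq e (fun S => ‖ψ S‖ ^ (2 : ℝ≥0∞).toReal)]
      exact Summable.tsum_le_tsum (hle ψ) ((memℓp_gen_iff h2).1 (hmem ψ)) (hsum ψ))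

@[simp]
theorem weightedPerm_apply {d : ℕ} (c : Finset (Lattice d) → ℂ)
    (e : Equiv.Perm (Finset (Lattice d))) (hc : ∀ S, ‖c S‖ ≤ 1) (ψ : Fock d)
    (S : Finset (Lattice d)) : weightedPerm c e hc ψ S = c S * ψ (e S) := rfl

theorem weightedPerm_norm_le {d : ℕ} (c : Finset (Lattice d) → ℂ)
    (e : Equiv.Perm (Finset (Lattice d))) (hc : ∀ S, ‖c S‖ ≤ 1) (ψ : Fock d) :
    ‖weightedPerm c e hc ψ‖ ≤ ‖ψ‖ := by
  refine (ContinuousLinearMap.le_opNorm _ ψ).trans ?_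
  refine mul_le_of_le_one_left (norm_nonneg _) ?_
  unfold weightedPerm
  exact LinearMap.mkContinuous_norm_le _ zero_le_one _

/-- Adding the site `x` to a configuration if it is empty, removing it if it is occupied. -/
def toggle {d : ℕ} (x : Lattice d) : Equiv.Perm (Finset (Lattice d)) :=
  Function.Involutive.toPerm (fun S => symmDiff S {x}) fun S => by simp

/-- The lexicographic total order of the sites. -/
def SiteLT {d : ℕ} (x y : Lattice d) : Prop := toLex x < toLex y

theorem siteLT_irrefl {d : ℕ} (x : Lattice d) : ¬ SiteLT x x :=
  lt_irrefl (toLex x)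

theorem SiteLT.asymm {d : ℕ} {x y : Lattice d} (h : SiteLT x y) : ¬ SiteLT y x :=
  lt_asymm (a := toLex x) h

theorem siteLT_trichotomy {d : ℕ} (x y : Lattice d) : SiteLT x y ∨ x = y ∨ SiteLT y x :=
  (lt_trichotomy (toLex x) (toLex y)).imp id (Or.imp (fun h => toLex.injective h) id)

theorem siteLT_add_right {d : ℕ} (x y z : Lattice d) : SiteLT (x + z) (y + z) ↔ SiteLT x y :=
  add_lt_add_iff_right (a := toLex z) (b := toLex x) (c := toLex y)

open Classical in
/-- The fermionic sign `(-1)^{#{y ∈ S : y < x}}`, the sites being ordered lexicographically. -/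
def jwSign {d : ℕ} (x : Lattice d) (S : Finset (Lattice d)) : ℂ :=
  (-1) ^ (S.filter fun y => SiteLT y x).card

/-- The annihilation operator at the site `x`: `e_S ↦ ± e_{S \ {x}}` if `x ∈ S`, and `e_S ↦ 0`
otherwise. In coordinates `(a_x ψ)(S) = ± ψ(S ∪ {x})` if `x ∉ S`, and `0` otherwise. -/
def fockA {d : ℕ} (x : Lattice d) : Fock d →L[ℂ] Fock d :=
  weightedPerm (fun S => if x ∈ S then 0 else jwSign x S) (toggle x) fun S => by
    split_ifs <;> simp [jwSign]

/-! ### The CAR algebra -/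

/-- The norm closed `*`-algebra generated by the unit and all annihilation operators. -/
def carSubalgebra (d : ℕ) : StarSubalgebra ℂ (Fock d →L[ℂ] Fock d) :=
  (StarAlgebra.adjoin ℂ (Set.range (fockA (d := d)))).topologicalClosure


theorem isClosed_carSubalgebra (d : ℕ) :
    IsClosed (carSubalgebra d : Set (Fock d →L[ℂ] Fock d)) :=
  StarSubalgebra.isClosed_topologicalClosure _

/-- The lattice CAR `C*`-algebra `𝒰`. -/
def CAR (d : ℕ) : Type := carSubalgebra d

/-- The `C*`-algebra structure that `𝒰` inherits from the bounded operators on the Fock space. -/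
def carCStarAlgebra (d : ℕ) : CStarAlgebra (CAR d) :=
  StarSubalgebra.cstarAlgebra (carSubalgebra d) (h_closed := isClosed_carSubalgebra d)

instance instCStarAlgebraCAR (d : ℕ) : CStarAlgebra (CAR d) := carCStarAlgebra d

/-- The generators `a_x ∈ 𝒰`. -/
def ann {d : ℕ} (x : Lattice d) : CAR d :=
  Subtype.mk (fockA x) (StarSubalgebra.le_topologicalClosure _
    (StarAlgebra.subset_adjoin ℂ _ (Set.mem_range_self x)))

/-- The local CAR algebra `𝒰_Λ`, generated by the unit and `a_x`, `x ∈ Λ`. -/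
def localAlg {d : ℕ} (Λ : Finset (Lattice d)) : StarSubalgebra ℂ (CAR d) :=
  StarAlgebra.adjoin ℂ (ann '' (Λ : Set (Lattice d)))

/-- Conjugation by a unitary of the Fock space that maps generators of `𝒰` into `𝒰`, in both
directions, restricts to a `*`-automorphism of `𝒰`. -/
theorem conj_mem {d : ℕ} (U : Fock d ≃ₗᵢ[ℂ] Fock d)
    (h : ∀ x, U.conjStarAlgEquiv (fockA x) ∈ carSubalgebra d)
    (b : Fock d →L[ℂ] Fock d) (hb : b ∈ carSubalgebra d) :
    U.conjStarAlgEquiv b ∈ carSubalgebra d := by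
  have hcont : Continuous fun b : Fock d →L[ℂ] Fock d => U.conjStarAlgEquiv b := by
    simp only [LinearIsometryEquiv.conjStarAlgEquiv_apply]
    fun_prop
  have hle : StarAlgebra.adjoin ℂ (Set.range (fockA (d := d))) ≤
      (carSubalgebra d).comap (U.conjStarAlgEquiv : _ →⋆ₐ[ℂ] _) := by
    refine StarAlgebra.adjoin_le ?_
    rintro _ ⟨x, rfl⟩
    exact h x
  have hcl := (isClosed_carSubalgebra d).preimage hcont
  exact StarSubalgebra.topologicalClosure_minimal hle hcl hb

/-- The `*`-automorphism of `𝒰` obtained by conjugation with a unitary of the Fock space. -/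
def conjAut {d : ℕ} (U : Fock d ≃ₗᵢ[ℂ] Fock d)
    (h : ∀ x, U.conjStarAlgEquiv (fockA x) ∈ carSubalgebra d)
    (h' : ∀ x, U.symm.conjStarAlgEquiv (fockA x) ∈ carSubalgebra d) : CAR d ≃⋆ₐ[ℂ] CAR d where
  toFun b := Subtype.mk (U.conjStarAlgEquiv b.1) (conj_mem U h b.1 b.2)
  invFun b := Subtype.mk (U.symm.conjStarAlgEquiv b.1) (conj_mem U.symm h' b.1 b.2)
  left_inv b := Subtype.ext (by ext; simp)
  right_inv b := Subtype.ext (by ext; simp)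
  map_mul' a b := Subtype.ext (map_mul U.conjStarAlgEquiv a.1 b.1)
  map_add' a b := Subtype.ext (map_add U.conjStarAlgEquiv a.1 b.1)
  map_star' a := Subtype.ext (map_star U.conjStarAlgEquiv a.1)
  map_smul' r a := Subtype.ext (map_smul U.conjStarAlgEquiv r a.1)

theorem weighted_inv {d : ℕ} (c c' : Finset (Lattice d) → ℂ)
    (e : Equiv.Perm (Finset (Lattice d))) (hc : ∀ S, ‖c S‖ ≤ 1) (hc' : ∀ S, ‖c' S‖ ≤ 1)
    (h : ∀ S, c' S * c (e.symm S) = 1) (ψ : Fock d) :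
    weightedPerm c' e.symm hc' (weightedPerm c e hc ψ) = ψ := by
  ext S
  simp [← mul_assoc, h]

/-- The unitary `(U ψ)(S) = c(S) ψ(e S)` with inverse `(U⁻¹ ψ)(S) = c'(S) ψ(e⁻¹ S)`. -/
def weightedUnitary {d : ℕ} (c c' : Finset (Lattice d) → ℂ)
    (e : Equiv.Perm (Finset (Lattice d))) (hc : ∀ S, ‖c S‖ ≤ 1) (hc' : ∀ S, ‖c' S‖ ≤ 1)
    (h : ∀ S, c' S * c (e.symm S) = 1) : Fock d ≃ₗᵢ[ℂ] Fock d :=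
  { toFun := weightedPerm c e hc
    invFun := weightedPerm c' e.symm hc'
    map_add' := map_add _
    map_smul' := map_smul _
    left_inv := weighted_inv c c' e hc hc' h
    right_inv := weighted_inv c' c e.symm hc' hc fun S => by
      have := h (e S)
      rwa [Equiv.symm_apply_apply, mul_comm] at this
    norm_map' := fun ψ => le_antisymm (weightedPerm_norm_le c e hc ψ)
      ((congrArg norm (weighted_inv c c' e hc hc' h ψ)).ge.trans
        (weightedPerm_norm_le c' e.symm hc' (weightedPerm c e hc ψ))) }

theorem weightedUnitary_apply {d : ℕ} (c c' : Finset (Lattice d) → ℂ)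
    (e : Equiv.Perm (Finset (Lattice d))) (hc : ∀ S, ‖c S‖ ≤ 1) (hc' : ∀ S, ‖c' S‖ ≤ 1)
    (h : ∀ S, c' S * c (e.symm S) = 1) (ψ : Fock d) (S : Finset (Lattice d)) :
    weightedUnitary c c' e hc hc' h ψ S = c S * ψ (e S) := rfl

theorem weightedUnitary_symm_apply {d : ℕ} (c c' : Finset (Lattice d) → ℂ)
    (e : Equiv.Perm (Finset (Lattice d))) (hc : ∀ S, ‖c S‖ ≤ 1) (hc' : ∀ S, ‖c' S‖ ≤ 1)
    (h : ∀ S, c' S * c (e.symm S) = 1) (ψ : Fock d) (S : Finset (Lattice d)) :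
    (weightedUnitary c c' e hc hc' h).symm ψ S = c' S * ψ (e.symm S) := rfl

/-- The lattice translation by `z` on configurations, in the form `S ↦ S - z`. -/
def shiftConf {d : ℕ} (z : Lattice d) : Equiv.Perm (Finset (Lattice d)) :=
  (Equiv.addRight (-z)).finsetCongr

/-- The unitary `e_S ↦ e_{S + z}`. -/
def shiftU {d : ℕ} (z : Lattice d) : Fock d ≃ₗᵢ[ℂ] Fock d :=
  weightedUnitary (fun _ => 1) (fun _ => 1) (shiftConf z) (by simp) (by simp) (by simp)

/-- The unitary `e_S ↦ (-1)^{|S|} e_S`. -/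
def parityU (d : ℕ) : Fock d ≃ₗᵢ[ℂ] Fock d :=
  weightedUnitary (fun S => (-1) ^ S.card) (fun S => (-1) ^ S.card) (Equiv.refl _)
    (by simp) (by simp) (fun S => by simp [← mul_pow])

theorem toggle_apply {d : ℕ} (x : Lattice d) (S : Finset (Lattice d)) :
    toggle x S = symmDiff S {x} := rfl

theorem mem_shiftConf {d : ℕ} (z y : Lattice d) (S : Finset (Lattice d)) :
    y ∈ shiftConf z S ↔ y + z ∈ S := by
  simp [shiftConf]

theorem shiftConf_symm {d : ℕ} (z : Lattice d) : (shiftConf z).symm = shiftConf (-z) := by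
  ext S y
  rw [mem_shiftConf]
  have := mem_shiftConf z (y + -z) ((shiftConf z).symm S)
  rw [Equiv.apply_symm_apply, neg_add_cancel_right] at this
  exact this.symm

theorem jwSign_shiftConf {d : ℕ} (z x : Lattice d) (S : Finset (Lattice d)) :
    jwSign x (shiftConf z S) = jwSign (x + z) S := by
  classical
  unfold jwSign
  congr 1
  refine Finset.card_bij (fun y _ => y + z) ?_ ?_ ?_
  · intro y hy
    rw [Finset.mem_filter, mem_shiftConf] at hy
    rw [Finset.mem_filter]
    exact ⟨hy.1, (siteLT_add_right y x z).2 hy.2⟩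
  · intro y _ y' _ h
    exact add_right_cancel h
  · intro y hy
    rw [Finset.mem_filter] at hy
    refine ⟨y - z, ?_, sub_add_cancel y z⟩
    rw [Finset.mem_filter, mem_shiftConf, sub_add_cancel]
    refine ⟨hy.1, (siteLT_add_right (y - z) x z).1 ?_⟩
    rw [sub_add_cancel]
    exact hy.2

theorem shiftU_apply {d : ℕ} (z : Lattice d) (ψ : Fock d) (S : Finset (Lattice d)) :
    shiftU z ψ S = ψ (shiftConf z S) := by
  rw [shiftU, weightedUnitary_apply, one_mul]

theorem shiftU_symm {d : ℕ} (z : Lattice d) : (shiftU z).symm = shiftU (-z) := by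
  ext ψ S
  rw [shiftU_apply, ← shiftConf_symm, shiftU, weightedUnitary_symm_apply, one_mul]

theorem shiftU_conj {d : ℕ} (z x : Lattice d) :
    (shiftU z).conjStarAlgEquiv (fockA x) = fockA (x + z) := by
  ext ψ S
  have h : (shiftConf z).symm (toggle x (shiftConf z S)) = toggle (x + z) S := by
    rw [Equiv.symm_apply_eq]
    ext y
    simp [toggle_apply, mem_shiftConf, Finset.mem_symmDiff]
  rw [LinearIsometryEquiv.conjStarAlgEquiv_apply_apply, shiftU_symm, shiftU_apply, fockA, fockA,
    weightedPerm_apply, weightedPerm_apply, shiftU_apply, ← shiftConf_symm, h, jwSign_shiftConf]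
  simp only [mem_shiftConf]

theorem parityU_apply {d : ℕ} (ψ : Fock d) (S : Finset (Lattice d)) :
    parityU d ψ S = (-1) ^ S.card * ψ S := rfl

theorem parityU_symm (d : ℕ) : (parityU d).symm = parityU d := by
  ext ψ S
  rfl

theorem parityU_conj {d : ℕ} (x : Lattice d) :
    (parityU d).conjStarAlgEquiv (fockA x) = -fockA x := by
  ext ψ S
  rw [LinearIsometryEquiv.conjStarAlgEquiv_apply_apply, parityU_symm, parityU_apply]
  change _ = -(fockA x ψ S)
  rw [fockA, weightedPerm_apply, weightedPerm_apply, parityU_apply]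
  split_ifs with hx
  · simp
  · have h : toggle x S = insert x S := by
      ext y
      simp only [toggle_apply, Finset.mem_symmDiff, Finset.mem_singleton, Finset.mem_insert]
      by_cases hy : y = x
      · subst hy; simp [hx]
      · simp [hy]
    have h1 : ((-1 : ℂ) ^ S.card) * (-1) ^ S.card = 1 := by simp [← mul_pow]
    rw [h, Finset.card_insert_of_notMem hx, pow_succ]
    linear_combination (-(jwSign x S * ψ (insert x S))) * h1

/-- The group of lattice translations: the `*`-automorphism `χ_z` of `𝒰` with
`χ_z(a_x) = a_{x + z}`, see `translation_ann`. -/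
def translation {d : ℕ} (z : Lattice d) : CAR d ≃⋆ₐ[ℂ] CAR d :=
  conjAut (shiftU z) (fun x => by rw [shiftU_conj]; exact (ann (x + z)).2)
    (fun x => by rw [shiftU_symm, shiftU_conj]; exact (ann (x + -z)).2)

theorem translation_ann {d : ℕ} (z x : Lattice d) : translation z (ann x) = ann (x + z) :=
  Subtype.ext (shiftU_conj z x)

/-- The parity automorphism `σ_π` of `𝒰` with `σ_π(a_x) = -a_x`, see `parity_ann`. -/
def parity (d : ℕ) : CAR d ≃⋆ₐ[ℂ] CAR d :=
  conjAut (parityU d) (fun x => by rw [parityU_conj]; exact neg_mem (ann x).2)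
    (fun x => by rw [parityU_symm, parityU_conj]; exact neg_mem (ann x).2)

theorem parity_ann {d : ℕ} (x : Lattice d) : parity d (ann x) = -ann x :=
  Subtype.ext (parityU_conj x)

/-! The generators satisfy the canonical anti-commutation relations. -/

theorem toggle_toggle {d : ℕ} (x : Lattice d) (S : Finset (Lattice d)) :
    toggle x (toggle x S) = S := by
  simp [toggle_apply]

theorem mem_toggle {d : ℕ} (x y : Lattice d) (S : Finset (Lattice d)) :
    y ∈ toggle x S ↔ (y ∈ S ↔ y ≠ x) := by
  rw [toggle_apply, Finset.mem_symmDiff, Finset.mem_singleton]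
  tauto

theorem toggle_comm {d : ℕ} (x y : Lattice d) (S : Finset (Lattice d)) :
    toggle x (toggle y S) = toggle y (toggle x S) := by
  ext z
  simp only [mem_toggle]
  tauto

theorem jwSign_mul_self {d : ℕ} (x : Lattice d) (S : Finset (Lattice d)) :
    jwSign x S * jwSign x S = 1 := by
  simp [jwSign, ← mul_pow]

open Classical in
theorem jwSign_toggle {d : ℕ} (x y : Lattice d) (S : Finset (Lattice d)) :
    jwSign x (toggle y S) = if SiteLT y x then -jwSign x S else jwSign x S := by
  unfold jwSign
  split_ifs with h
  · by_cases hy : y ∈ S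
    · have : S.filter (fun z => SiteLT z x) =
          insert y ((toggle y S).filter fun z => SiteLT z x) := by
        ext z
        by_cases hz : z = y
        · subst hz; simp [hy, h]
        · simp [mem_toggle, hz]
      rw [this, Finset.card_insert_of_notMem (by simp [mem_toggle, hy])]
      ring
    · have : (toggle y S).filter (fun z => SiteLT z x) =
          insert y (S.filter fun z => SiteLT z x) := by
        ext z
        by_cases hz : z = y
        · subst hz; simp [mem_toggle, hy, h]
        · simp [mem_toggle, hz]
      rw [this, Finset.card_insert_of_notMem (by simp [hy])]
      ring
  · congr 2
    ext z
    by_cases hz : z = y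
    · subst hz; simp [h]
    · simp [mem_toggle, hz]

theorem star_fockA_apply {d : ℕ} (x : Lattice d) (ψ : Fock d) (S : Finset (Lattice d)) :
    (star (fockA x)) ψ S = (if x ∈ S then jwSign x S else 0) * ψ (toggle x S) := by
  have hc : ∀ S : Finset (Lattice d), ‖(if x ∈ S then jwSign x S else 0 : ℂ)‖ ≤ 1 := fun S => by
    split_ifs <;> simp [jwSign]
  have h : weightedPerm (fun S => if x ∈ S then jwSign x S else 0) (toggle x) hc =
      star (fockA x) := by
    rw [ContinuousLinearMap.star_eq_adjoint, ContinuousLinearMap.eq_adjoint_iff]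
    intro u v
    rw [lp.inner_eq_tsum, lp.inner_eq_tsum, ← Equiv.tsum_eq (toggle x)]
    congr 1
    ext S
    rw [fockA, weightedPerm_apply, weightedPerm_apply, toggle_toggle, jwSign_toggle]
    by_cases hx : x ∈ S <;> simp [mem_toggle, hx, siteLT_irrefl, jwSign]
    ring
  rw [← h, weightedPerm_apply]

theorem ann_mul_ann {d : ℕ} (x y : Lattice d) : ann x * ann y + ann y * ann x = 0 := by
  refine Subtype.ext ?_
  change fockA x * fockA y + fockA y * fockA x = 0
  ext ψ S
  change fockA x (fockA y ψ) S + fockA y (fockA x ψ) S = 0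
  simp only [fockA, weightedPerm_apply, mem_toggle, jwSign_toggle, toggle_comm x y]
  rcases siteLT_trichotomy x y with h | h | h
  · have hne : x ≠ y := fun e => siteLT_irrefl y (e ▸ h)
    by_cases hx : x ∈ S <;> by_cases hy : y ∈ S <;>
      simp [hx, hy, hne, hne.symm, h, h.asymm]
    ring
  · have hxy : x = y := h
    subst hxy
    by_cases hx : x ∈ S <;> simp [hx]
  · have hne : x ≠ y := fun e => siteLT_irrefl y (e ▸ h)
    by_cases hx : x ∈ S <;> by_cases hy : y ∈ S <;>
      simp [hx, hy, hne, hne.symm, h, h.asymm]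
    ring

theorem ann_mul_star_ann {d : ℕ} (x y : Lattice d) :
    ann x * star (ann y) + star (ann y) * ann x = if x = y then 1 else 0 := by
  have key : fockA x * star (fockA y) + star (fockA y) * fockA x =
      if x = y then (1 : Fock d →L[ℂ] Fock d) else 0 := by
    ext ψ S
    change fockA x (star (fockA y) ψ) S + star (fockA y) (fockA x ψ) S = _
    rw [star_fockA_apply, fockA, weightedPerm_apply, weightedPerm_apply, star_fockA_apply,
      toggle_comm x y]
    simp only [mem_toggle, jwSign_toggle]
    rcases siteLT_trichotomy x y with h | h | h
    · have hne : x ≠ y := fun e => siteLT_irrefl y (e ▸ h)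
      by_cases hx : x ∈ S <;> by_cases hy : y ∈ S <;>
        simp [hx, hy, hne, hne.symm, h, h.asymm]
      ring
    · have hxy : x = y := h
      subst hxy
      by_cases hx : x ∈ S <;> simp [hx, toggle_toggle, ← mul_assoc, jwSign_mul_self, siteLT_irrefl]
    · have hne : x ≠ y := fun e => siteLT_irrefl y (e ▸ h)
      by_cases hx : x ∈ S <;> by_cases hy : y ∈ S <;>
        simp [hx, hy, hne, hne.symm, h, h.asymm]
      ring
  refine Subtype.ext (Eq.trans key ?_)
  split_ifs <;> rfl

/-- Even elements of `𝒰`, that is, the elements of `𝒰⁺`. -/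
def IsEven {d : ℕ} (b : CAR d) : Prop := parity d b = b

/-! ### Interactions, potentials, decay functions -/

/-- An interaction: a family of even self-adjoint elements `Φ_Λ ∈ 𝒰_Λ`, with `Φ_∅ = 0`. -/
structure Interaction (d : ℕ) where
  toFun : Finset (Lattice d) → CAR d
  isEven : ∀ Λ, IsEven (toFun Λ)
  isSelfAdjoint : ∀ Λ, IsSelfAdjoint (toFun Λ)
  mem_localAlg : ∀ Λ, toFun Λ ∈ localAlg Λ
  map_empty : toFun ∅ = 0

/-- A potential: a family of even self-adjoint elements `V_x ∈ 𝒰_{{x}}`. -/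
structure Potential (d : ℕ) where
  toFun : Lattice d → CAR d
  isEven : ∀ x, IsEven (toFun x)
  isSelfAdjoint : ∀ x, IsSelfAdjoint (toFun x)
  mem_localAlg : ∀ x, toFun x ∈ localAlg {x}

/-- The convolution constant
`sup_{x,y} ∑_z F(|x - z|) F(|z - y|) / F(|x - y|) ∈ [0, ∞]`. -/
def convConst (d : ℕ) (F : ℝ≥0 → ℝ) : ℝ≥0∞ :=
  ⨆ (x : Lattice d) (y : Lattice d), ∑' z : Lattice d,
    ENNReal.ofReal (F (len (x - z)) * F (len (z - y)) / F (len (x - y)))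

/-- Decay functions: positive, non-increasing, summable on the lattice and with finite
convolution constant. -/
structure DecayFunction (d : ℕ) where
  toFun : ℝ≥0 → ℝ
  pos : ∀ r, 0 < toFun r
  antitone : Antitone toFun
  summable : Summable fun x : Lattice d => toFun (len x)
  convConst_lt_top : convConst d toFun < ⊤

/-- The convolution constant `𝐃` of a decay function, as a real number. -/
def DecayFunction.D {d : ℕ} (F : DecayFunction d) : ℝ := (convConst d F.toFun).toReal

/-- The norm `‖Φ‖_𝒲 = sup_{x,y} ∑_{Λ ∋ x,y} ‖Φ_Λ‖ / F(|x - y|) ∈ [0, ∞]`; the space `𝒲` consists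
of the interactions for which it is finite. -/
def Interaction.normW {d : ℕ} (Φ : Interaction d) (F : DecayFunction d) : ℝ≥0∞ :=
  ⨆ (x : Lattice d) (y : Lattice d), ∑' Λ : {Λ : Finset (Lattice d) // x ∈ Λ ∧ y ∈ Λ},
    ENNReal.ofReal (‖Φ.toFun Λ‖ / F.toFun (len (x - y)))

/-- `‖Ψ‖_∞ = sup_t ‖Ψ^{(t)}‖_𝒲 ∈ [0, ∞]` for a time-dependent interaction. -/
def supNormW {d : ℕ} (Ψ : ℝ → Interaction d) (F : DecayFunction d) : ℝ≥0∞ :=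
  ⨆ t : ℝ, (Ψ t).normW F

/-! ### Non-autonomous dynamics -/

/-- The bounded operator `B ↦ [A, B] = A B - B A` on `𝒰`. -/
def commOp {d : ℕ} (A : CAR d) : CAR d →L[ℂ] CAR d :=
  ContinuousLinearMap.mul ℂ (CAR d) A - (ContinuousLinearMap.mul ℂ (CAR d)).flip A

/-- The finite-volume derivation
`δ^{(L)}(B) = i ∑_{Λ ⊆ Λ_L} [Φ_Λ, B] + i ∑_{x ∈ Λ_L} [V_x, B]`. -/
def derivation {d : ℕ} (Φ : Interaction d) (V : Potential d) (L : ℝ≥0) : CAR d →L[ℂ] CAR d :=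
  Complex.I • (∑ Λ ∈ (box (L : ℝ)).powerset, commOp (Φ.toFun Λ)) +
    Complex.I • ∑ x ∈ box (L : ℝ), commOp (V.toFun x)

/-- `τ` is the finite-volume dynamics in `Λ_L`: a solution of
`∂_t τ_{t,s} = τ_{t,s} ∘ δ_t^{(L)}`, `∂_s τ_{t,s} = - δ_s^{(L)} ∘ τ_{t,s}`, `τ_{s,s} = 1`. -/
structure IsFiniteVolumeDynamics {d : ℕ} (Ψ : ℝ → Interaction d) (V : ℝ → Potential d) (L : ℝ≥0)
    (τ : ℝ → ℝ → CAR d →L[ℂ] CAR d) : Prop where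
  deriv_left : ∀ t s, HasDerivAt (fun r => τ r s) (τ t s ∘L derivation (Ψ t) (V t) L) t
  deriv_right : ∀ t s, HasDerivAt (fun r => τ t r) (-(derivation (Ψ s) (V s) L ∘L τ t s)) s
  diag : ∀ s, τ s s = ContinuousLinearMap.id ℂ (CAR d)

/-- `τ` is the infinite-volume dynamics: the strong limit of the finite-volume dynamics as
`L → ∞`. -/
def IsInfiniteVolumeDynamics {d : ℕ} (Ψ : ℝ → Interaction d) (V : ℝ → Potential d)
    (τ : ℝ → ℝ → CAR d →L[ℂ] CAR d) : Prop :=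
  ∃ τL : ℝ≥0 → ℝ → ℝ → CAR d →L[ℂ] CAR d,
    (∀ L, IsFiniteVolumeDynamics Ψ V L (τL L)) ∧
    ∀ t s B, Filter.Tendsto (fun L => τL L t s B) Filter.atTop (nhds (τ t s B))

/-! ### Multi-commutators, trees, and the bound -/

/-- The multi-commutator `[B_k, …, B_0]^{(k+1)} = [B_k, [B_{k-1}, …, [B_1, B_0] … ]]`. -/
def multiComm {A : Type*} [Ring A] (B : ℕ → A) : ℕ → A
  | 0 => B 0
  | k + 1 => B (k + 1) * multiComm B k - multiComm B k * B (k + 1)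

/-- `trees k` is the set `𝒯_{k+1}` of trees on the vertices `0, …, k`, each given by its set of
bonds: `𝒯_{k+2} = {T ∪ {{j, k+1}} : j ≤ k, T ∈ 𝒯_{k+1}}`, starting from the tree without bonds
on the vertex `0`; in particular `𝒯_2 = {{{0, 1}}}`. -/
def trees : ℕ → Finset (Finset (Sym2 ℕ))
  | 0 => {∅}
  | k + 1 => (Finset.range (k + 1) ×ˢ trees k).image fun p => insert s(p.1, k + 1) p.2

/-- The parent map `P_T`: for `T ∈ 𝒯_{k+1}` and `1 ≤ j ≤ k`, the only vertex `i < j` which is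
joined to `j` by a bond of `T`. -/
def parent (T : Finset (Sym2 ℕ)) (j : ℕ) : ℕ := sInf {i | i < j ∧ s(i, j) ∈ T}

/-- The characteristic function `ϰ_T({(n_j, x_j)}_{j=0}^k) ∈ {0, 1}`. -/
def kappa {d : ℕ} (k : ℕ) (T : Finset (Sym2 ℕ)) (n : ℕ → ℕ) (x : ℕ → Lattice d) : ℝ :=
  ∏ j ∈ Finset.Icc 1 k,
    if (boxAt (n j) (x j) ∩ boxAt (n (parent T j)) (x (parent T j))).Nonempty then 1 else 0

open Classical in
/-- The set `𝒮_{ℓ,k}` of strictly increasing maps `{ℓ, …, k} → {1, …, k}`. -/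
def increasingMaps (l k : ℕ) : Finset (Finset.Icc l k → Finset.Icc 1 k) :=
  Finset.univ.filter StrictMono

/-- The image `{π(ℓ), …, π(k)}`. -/
def imageSet {l k : ℕ} (π : Finset.Icc l k → Finset.Icc 1 k) : Finset ℕ :=
  Finset.univ.image fun i => (π i : ℕ)

/-- The sequence equal to `n_j` for `j ∈ J` and to `m_j` for all other `j`. -/
def extendBy (J : Finset ℕ) (n : J → ℕ) (m : ℕ → ℕ) (j : ℕ) : ℕ :=
  if h : j ∈ J then n ⟨j, h⟩ else m j

/-- The quantity `ℜ_{T,α}`, with times `t_1, …, t_k`. The sums over `n_j ≥ m_j + 1`,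
`z_j ∈ Λ_{m_j}`, `y_j ∈ Λ_{n_j} \ Λ_{n_j - 1}`, `j ∈ J = {π(ℓ), …, π(k)}`, are written as sums
over families indexed by `J`. -/
def remainder {d : ℕ} (F : DecayFunction d) (k : ℕ) (T : Finset (Sym2 ℕ)) (α : ℝ) (t : ℕ → ℝ)
    (m : ℕ → ℕ) (x : ℕ → Lattice d) : ℝ :=
  ∑ l ∈ Finset.Icc 1 k, (2 * α) ^ (k - l + 1) * ∑ π ∈ increasingMaps l k,
    (∏ j ∈ imageSet π, |t j| * Real.exp (4 * F.D * α * |t j|)) *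
      ∑' n : {n : imageSet π → ℕ // ∀ j : imageSet π, m j + 1 ≤ n j},
        ∑ z ∈ Fintype.piFinset fun j : imageSet π => box (d := d) (m j),
          ∑ y ∈ Fintype.piFinset fun j : imageSet π =>
              box (d := d) (n.1 j) \ box ((n.1 j : ℝ) - 1),
            kappa k T (extendBy (imageSet π) n.1 m) x *
              ∏ j : imageSet π, F.toFun (len (z j - y j))

end FermiLattice

end

/-!
The finite-volume dynamics is conjugation by the unitary propagator of a local Hamiltonian, given by
a Dyson series. As the potential is unbounded in space, it must not enter the estimates: since it
acts site by site, it generates automorphisms preserving localization, and rotating it away leaves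
only the interaction in Duhamel's formula. Iterating that formula, with the constant `D` absorbing
each convolution of `F`, bounds `‖⁅τ_{t,s}(B), A⁆‖` by
`2 ‖A‖ ‖B‖ ∑_{x,y} (1_{x = y} + (e^{2 D α |t - s|} - 1) D⁻¹ F(|x - y|))`, with `x` and `y` running
over the supports of `B` and `A`, uniformly in the volume. Hence the dynamics converges.

For multi-commutators, expand each `τ(B_j)` as the telescoping sum of its differences along the
dynamics in the growing boxes `Λ_n + x_j`, `n ≥ m_j`: the term `n = m_j` has norm at most `‖B_j‖`,
and the term `n > m_j` is small by the Lieb–Robinson bound. A multi-commutator of even elements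
localized in boxes vanishes unless each box meets an earlier one, in which case some tree `T` has
`ϰ_T = 1`. Summing the norms over the set `J` of the indices with `n_j > m_j` gives `ℜ_{T,α}`.
-/

namespace FermiLattice

/-! ### Mean value estimates -/

section MeanValue

variable {E : Type*} [NormedAddCommGroup E] [NormedSpace ℝ E]

theorem exists_affine_reparam (s t : ℝ) :
    ∃ ε : ℝ, |ε| = 1 ∧ s + ε * |t - s| = t ∧ ∀ u, |s + ε * u - s| = |u| := by
  rcases le_total s t with h | h
  · exact ⟨1, by simp, by simp [abs_of_nonneg (sub_nonneg.2 h)], by simp⟩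
  · exact ⟨-1, by simp, by simp [abs_of_nonpos (sub_nonpos.2 h)], by simp⟩

theorem norm_le_of_norm_deriv_le {f f' : ℝ → E} {β β' : ℝ → ℝ} (s t : ℝ)
    (hf : ∀ r, HasDerivAt f (f' r) r) (hβ : ∀ u, HasDerivAt β (β' u) u) (h0 : ‖f s‖ ≤ β 0)
    (h : ∀ r, |r - s| ≤ |t - s| → ‖f' r‖ ≤ β' |r - s|) : ‖f t‖ ≤ β |t - s| := by
  obtain ⟨ε, hε, hst, hu⟩ := exists_affine_reparam s t
  have hg : ∀ u, HasDerivAt (fun u => f (s + ε * u)) (ε • f' (s + ε * u)) u := fun u =>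
    (hf (s + ε * u)).scomp u (by simpa using ((hasDerivAt_id u).const_mul ε).const_add s)
  have hg' : ∀ u ∈ Set.Ico 0 |t - s|, ‖ε • f' (s + ε * u)‖ ≤ β' u := fun u hu' => by
    have habs : |s + ε * u - s| = u := by rw [hu, abs_of_nonneg hu'.1]
    rw [norm_smul, Real.norm_eq_abs, hε, one_mul, ← habs]
    exact habs.symm ▸ h (s + ε * u) (habs.trans_le hu'.2.le)
  simpa [hst] using image_norm_le_of_norm_deriv_right_le_deriv_boundary
    (fun u _ => (hg u).continuousAt.continuousWithinAt) (fun u _ => (hg u).hasDerivWithinAt)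
    (by simpa using h0) hβ hg' ⟨abs_nonneg (t - s), le_rfl⟩

theorem norm_sub_le_of_norm_deriv_le {f f' : ℝ → E} {C : ℝ} (s t : ℝ)
    (hf : ∀ r, HasDerivAt f (f' r) r)
    (h : ∀ r, |r - s| ≤ |t - s| → |t - r| ≤ |t - s| → ‖f' r‖ ≤ C) :
    ‖f t - f s‖ ≤ C * |t - s| :=
  (convex_uIcc s t).norm_image_sub_le_of_norm_hasDerivWithin_le
    (fun r _ => (hf r).hasDerivWithinAt)
    (fun r hr => h r (Set.abs_sub_left_of_mem_uIcc hr) (Set.abs_sub_right_of_mem_uIcc hr))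
    Set.left_mem_uIcc Set.right_mem_uIcc

theorem eq_of_hasDerivAt_zero {f : ℝ → E} (hf : ∀ r, HasDerivAt f 0 r) (s t : ℝ) : f s = f t :=
  is_const_of_deriv_eq_zero (fun r => (hf r).differentiableAt) (fun r => (hf r).deriv) s t

theorem hasDerivAt_mul_pow_div_factorial (M : ℝ) (n : ℕ) (u : ℝ) :
    HasDerivAt (fun u => (M * u) ^ (n + 1) / (n + 1).factorial)
      (M * ((M * u) ^ n / n.factorial)) u := by
  have hlin : HasDerivAt (fun u : ℝ => M * u) M u := by
    simpa using (hasDerivAt_id u).const_mul M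
  refine ((hlin.pow (n + 1)).div_const ((n + 1).factorial : ℝ)).congr_deriv ?_
  have : (n.factorial : ℝ) ≠ 0 := by positivity
  rw [Nat.factorial_succ]
  push_cast
  field_simp

end MeanValue

theorem exists_norm_le_of_abs_le {E : Type*} [SeminormedAddCommGroup E] {f : ℝ → E}
    (hf : Continuous f) (T : ℝ) : ∃ M, 0 ≤ M ∧ ∀ r, |r| ≤ T → ‖f r‖ ≤ M := by
  obtain ⟨M, hM⟩ := (isCompact_Icc (a := -T) (b := T)).exists_bound_of_continuousOn hf.continuousOn
  exact ⟨max M 0, le_max_right _ _, fun r hr => (hM r (abs_le.1 hr)).trans (le_max_left _ _)⟩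

/-! ### Propagators in Banach algebras -/

section Dyson

variable {𝔸 : Type*} [NormedRing 𝔸] [NormedAlgebra ℝ 𝔸]

/-- The terms of the Dyson series, which solves `P' = P K`, `P 0 = 1`. -/
noncomputable def dysonTerm (K : ℝ → 𝔸) : ℕ → ℝ → 𝔸
  | 0, _ => 1
  | n + 1, t => ∫ r in (0 : ℝ)..t, dysonTerm K n r * K r

/-- The Dyson series, that is, the time-ordered exponential of `K` between `0` and `t`. -/
noncomputable def dysonSeries (K : ℝ → 𝔸) (t : ℝ) : 𝔸 := ∑' n, dysonTerm K n t

variable {K : ℝ → 𝔸}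

theorem continuous_dysonTerm (hK : Continuous K) (n : ℕ) : Continuous (dysonTerm K n) := by
  induction n with
  | zero => exact continuous_const
  | succ n ih =>
    exact intervalIntegral.continuous_primitive (fun a b => (ih.mul hK).intervalIntegrable a b) 0

theorem dysonSeries_zero (K : ℝ → 𝔸) : dysonSeries K 0 = 1 := by
  refine (tsum_eq_single 0 fun n hn => ?_).trans rfl
  obtain ⟨n, rfl⟩ := Nat.exists_eq_succ_of_ne_zero hn
  simp [dysonTerm]

variable [CompleteSpace 𝔸]

theorem hasDerivAt_dysonTerm_succ (hK : Continuous K) (n : ℕ) (t : ℝ) :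
    HasDerivAt (dysonTerm K (n + 1)) (dysonTerm K n t * K t) t :=
  (((continuous_dysonTerm hK n).mul hK).integral_hasStrictDerivAt 0 t).hasDerivAt

theorem norm_dysonTerm_le (hK : Continuous K) {M T : ℝ} (hM : ∀ r, |r| ≤ T → ‖K r‖ ≤ M) (n : ℕ)
    {t : ℝ} (ht : |t| ≤ T) : ‖dysonTerm K n t‖ ≤ ‖(1 : 𝔸)‖ * ((M * |t|) ^ n / n.factorial) := by
  induction n generalizing t with
  | zero => simp [dysonTerm]
  | succ n ih =>
    have hβ := fun u => (hasDerivAt_mul_pow_div_factorial M n u).const_mul ‖(1 : 𝔸)‖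
    suffices h : ∀ r, |r - 0| ≤ |t - 0| →
        ‖dysonTerm K n r * K r‖ ≤ ‖(1 : 𝔸)‖ * (M * ((M * |r - 0|) ^ n / n.factorial)) by
      simpa using norm_le_of_norm_deriv_le 0 t (hasDerivAt_dysonTerm_succ hK n) hβ
        (by simp [dysonTerm]) h
    simp only [sub_zero]
    intro r hr
    calc ‖dysonTerm K n r * K r‖ ≤ ‖dysonTerm K n r‖ * ‖K r‖ := norm_mul_le _ _
      _ ≤ ‖(1 : 𝔸)‖ * ((M * |r|) ^ n / n.factorial) * M :=
        mul_le_mul (ih (hr.trans ht)) (hM r (hr.trans ht)) (norm_nonneg _)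
          ((norm_nonneg _).trans (ih (hr.trans ht)))
      _ = ‖(1 : 𝔸)‖ * (M * ((M * |r|) ^ n / n.factorial)) := by ring

theorem exists_summable_norm_dysonTerm_le (hK : Continuous K) (T : ℝ) :
    ∃ u : ℕ → ℝ, Summable u ∧ ∀ n r, |r| ≤ T → ‖dysonTerm K n r‖ ≤ u n := by
  obtain ⟨M, hM0, hM⟩ := exists_norm_le_of_abs_le hK T
  exact ⟨fun n => ‖(1 : 𝔸)‖ * ((M * T) ^ n / n.factorial),
    (Real.summable_pow_div_factorial _).mul_left _,
    fun n r hr => (norm_dysonTerm_le hK hM n hr).trans <|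
      mul_le_mul_of_nonneg_left (by gcongr) (norm_nonneg _)⟩

theorem summable_dysonTerm (hK : Continuous K) (t : ℝ) : Summable fun n => dysonTerm K n t := by
  obtain ⟨u, hu, hle⟩ := exists_summable_norm_dysonTerm_le hK |t|
  exact hu.of_norm_bounded fun n => hle n t le_rfl

theorem hasDerivAt_dysonSeries (hK : Continuous K) (t : ℝ) :
    HasDerivAt (dysonSeries K) (dysonSeries K t * K t) t := by
  set T := |t| + 1
  obtain ⟨u, hu, hle⟩ := exists_summable_norm_dysonTerm_le hK T
  obtain ⟨M, -, hM⟩ := exists_norm_le_of_abs_le hK T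
  have hbound : ∀ n, ∀ r ∈ Set.Ioo (-T) T, ‖dysonTerm K n r * K r‖ ≤ u n * M := fun n r hr => by
    have hr' : |r| ≤ T := abs_le.2 ⟨hr.1.le, hr.2.le⟩
    exact (norm_mul_le _ _).trans (mul_le_mul (hle n r hr') (hM r hr') (norm_nonneg _)
      ((norm_nonneg _).trans (hle n r hr')))
  have htT : t ∈ Set.Ioo (-T) T := abs_lt.1 (lt_add_one |t|)
  have hderiv := hasDerivAt_tsum_of_isPreconnected (hu.mul_right M) isOpen_Ioo isPreconnected_Ioo
    (fun n r _ => hasDerivAt_dysonTerm_succ hK n r) hbound htT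
    ((summable_nat_add_iff 1).2 (summable_dysonTerm hK t)) htT
  rw [(summable_dysonTerm hK t).tsum_mul_right] at hderiv
  refine (hderiv.const_add 1).congr_of_eventuallyEq (Filter.Eventually.of_forall fun r => ?_)
  exact (summable_dysonTerm hK r).tsum_eq_zero_add

end Dyson

section Propagator

variable {𝔸 : Type*} [NormedRing 𝔸] [NormedAlgebra ℝ 𝔸]

/-- `U` is the two-parameter family with `∂_t U_{t,s} = U_{t,s} K_t`, `∂_s U_{t,s} = -K_s U_{t,s}`
and `U_{s,s} = 1`. The order of the factors is the one of dynamics of observables, so that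
`U_{r,s} U_{t,r} = U_{t,s}`. -/
structure IsPropagator (K : ℝ → 𝔸) (U : ℝ → ℝ → 𝔸) : Prop where
  deriv_left : ∀ t s, HasDerivAt (fun r => U r s) (U t s * K t) t
  deriv_right : ∀ t s, HasDerivAt (fun r => U t r) (-(K s * U t s)) s
  diag : ∀ s, U s s = 1

namespace IsPropagator

variable {K K' : ℝ → 𝔸} {U U' : ℝ → ℝ → 𝔸}

theorem hasDerivAt_mul (hU : IsPropagator K U) (hU' : IsPropagator K' U') (t s r : ℝ) :
    HasDerivAt (fun r => U r s * U' t r) (U r s * (K r - K' r) * U' t r) r :=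
  ((hU.deriv_left r s).mul (hU'.deriv_right t r)).congr_deriv (by noncomm_ring)

theorem mul (hU : IsPropagator K U) (t r s : ℝ) : U r s * U t r = U t s := by
  have h := eq_of_hasDerivAt_zero (fun r => (hU.hasDerivAt_mul hU t s r).congr_deriv (by simp)) r t
  simpa [hU.diag] using h

theorem mul_swap (hU : IsPropagator K U) (t s : ℝ) : U t s * U s t = 1 := by
  rw [hU.mul, hU.diag]

theorem unique (hU : IsPropagator K U) (hU' : IsPropagator K U') : U = U' := by
  ext t s
  have h := eq_of_hasDerivAt_zero (fun r => (hU.hasDerivAt_mul hU' t s r).congr_deriv (by simp)) t s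
  simpa [hU.diag, hU'.diag] using h

theorem map {𝔹 : Type*} [NormedRing 𝔹] [NormedAlgebra ℝ 𝔹] (φ : 𝔸 →A[ℝ] 𝔹)
    (hU : IsPropagator K U) : IsPropagator (fun t => φ (K t)) fun t s => φ (U t s) where
  deriv_left t s := by
    simpa using! φ.toContinuousLinearMap.hasFDerivAt.comp_hasDerivAt t (hU.deriv_left t s)
  deriv_right t s := by
    simpa using! φ.toContinuousLinearMap.hasFDerivAt.comp_hasDerivAt s (hU.deriv_right t s)
  diag s := by simp [hU.diag]

end IsPropagator

theorem mul_eq_one_of_hasDerivAt [CompleteSpace 𝔸] {K P Q : ℝ → 𝔸} (hP0 : P 0 = 1) (hQ0 : Q 0 = 1)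
    (hP : ∀ t, HasDerivAt P (P t * K t) t) (hQ : ∀ t, HasDerivAt Q (-(K t * Q t)) t) (t : ℝ) :
    P t * Q t = 1 ∧ Q t * P t = 1 := by
  have hPQ : ∀ t, P t * Q t = 1 := fun t => by
    have h := eq_of_hasDerivAt_zero
      (fun r => ((hP r).mul (hQ r)).congr_deriv (by noncomm_ring)) t 0
    simpa [hP0, hQ0] using h
  have hPc : Continuous P := continuous_iff_continuousAt.2 fun t => (hP t).continuousAt
  have hQc : Continuous Q := continuous_iff_continuousAt.2 fun t => (hQ t).continuousAt
  -- A right inverse of a unit is its inverse, and units form an open set.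
  have hunit : {t | Q t * P t = 1} = {t | IsUnit (P t)} := by
    ext t
    refine ⟨fun h => ⟨⟨P t, Q t, hPQ t, h⟩, rfl⟩, fun h => ?_⟩
    rw [Set.mem_ofPred_eq, ← h.mul_right_inj, ← mul_assoc, hPQ, one_mul, mul_one]
  have hclopen : IsClopen {t | Q t * P t = 1} :=
    ⟨isClosed_eq (hQc.mul hPc) continuous_const, hunit ▸ Units.isOpen.preimage hPc⟩
  have huniv := hclopen.eq_univ ⟨0, by simp [hP0, hQ0]⟩
  exact ⟨hPQ t, huniv.ge (Set.mem_univ t)⟩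

theorem exists_isPropagator [CompleteSpace 𝔸] {K : ℝ → 𝔸} (hK : Continuous K) :
    ∃ U, IsPropagator K U := by
  set P := dysonSeries K
  set Q : ℝ → 𝔸 := fun t => (dysonSeries (fun t => MulOpposite.op (-K t)) t).unop
  have hP : ∀ t, HasDerivAt P (P t * K t) t := hasDerivAt_dysonSeries hK
  have hQ : ∀ t, HasDerivAt Q (-(K t * Q t)) t := fun t => by
    have h := hasDerivAt_dysonSeries (MulOpposite.continuous_op.comp hK.neg) t
    simpa [Q] using!
      (MulOpposite.opContinuousLinearEquiv ℝ).symm.hasFDerivAt.comp_hasDerivAt t h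
  have hPQ := mul_eq_one_of_hasDerivAt (dysonSeries_zero K) (by simp [Q, dysonSeries_zero]) hP hQ
  exact ⟨fun t s => Q s * P t,
    fun t s => ((hP t).const_mul (Q s)).congr_deriv (by rw [mul_assoc]),
    fun t s => ((hQ s).mul_const (P t)).congr_deriv (by noncomm_ring), fun s => (hPQ s).2⟩

theorem IsPropagator.mem_subalgebra [CompleteSpace 𝔸] {K : ℝ → 𝔸} {U : ℝ → ℝ → 𝔸}
    (hU : IsPropagator K U) (S : Subalgebra ℝ 𝔸) (hS : IsClosed (S : Set 𝔸)) (hK : Continuous K)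
    (hKS : ∀ t, K t ∈ S) (t s : ℝ) : U t s ∈ S := by
  have : CompleteSpace S := hS.completeSpace_coe
  obtain ⟨W, hW⟩ := exists_isPropagator (K := fun t => (⟨K t, hKS t⟩ : S)) (by fun_prop)
  have hUW : U = fun t s => (W t s : 𝔸) := hU.unique (hW.map S.valA)
  rw [hUW]
  exact (W t s).2

end Propagator

theorem norm_lie_le {R : Type*} [NormedRing R] (a b : R) : ‖⁅a, b⁆‖ ≤ 2 * ‖a‖ * ‖b‖ := by
  rw [Ring.lie_def]
  linarith [norm_sub_le (a * b) (b * a), norm_mul_le a b, norm_mul_le b a, mul_comm ‖a‖ ‖b‖]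

section ComplexBanachAlgebra

variable {A : Type*} [NormedRing A] [NormedAlgebra ℂ A]

/-- The commutator `a ↦ b ↦ ⁅a, b⁆` as a bounded bilinear map. -/
noncomputable def adCLM : A →L[ℂ] A →L[ℂ] A :=
  ContinuousLinearMap.mul ℂ A - (ContinuousLinearMap.mul ℂ A).flip

@[simp]
theorem adCLM_apply (a b : A) : adCLM a b = ⁅a, b⁆ := rfl

theorem IsPropagator.mulLeftRight {K : ℝ → A} {U : ℝ → ℝ → A} (hU : IsPropagator K U) :
    IsPropagator (fun t => adCLM (K t))
      fun t s => ContinuousLinearMap.mulLeftRight ℂ A (U t s) (U s t) where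
  deriv_left t s := by
    let B := (ContinuousLinearMap.mulLeftRight ℂ A).bilinearRestrictScalars ℝ
    refine (B.hasDerivAt_of_bilinear (fun _ => hU.deriv_left t s)
      fun _ => hU.deriv_right s t).congr_deriv ?_
    ext b
    simp only [B, ContinuousLinearMap.bilinearRestrictScalars_apply_apply,
      ContinuousLinearMap.mulLeftRight_apply, map_neg, add_apply, neg_apply, mul_apply_eq_comp,
      adCLM_apply, Ring.lie_def]
    noncomm_ring
  deriv_right t s := by
    let B := (ContinuousLinearMap.mulLeftRight ℂ A).bilinearRestrictScalars ℝ
    refine (B.hasDerivAt_of_bilinear (fun _ => hU.deriv_right t s)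
      fun _ => hU.deriv_left s t).congr_deriv ?_
    ext b
    simp only [B, ContinuousLinearMap.bilinearRestrictScalars_apply_apply,
      ContinuousLinearMap.mulLeftRight_apply, map_neg, add_apply, neg_apply, mul_apply_eq_comp,
      adCLM_apply, Ring.lie_def]
    noncomm_ring
  diag s := by
    ext b
    simp [hU.diag]

theorem IsPropagator.hasDerivAt_apply {E : Type*} [NormedAddCommGroup E] [NormedSpace ℂ E]
    {K : ℝ → E →L[ℂ] E} {U : ℝ → ℝ → E →L[ℂ] E} (hU : IsPropagator K U) (s : ℝ) {g : ℝ → E}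
    {g' : E} {r : ℝ} (hg : HasDerivAt g g' r) :
    HasDerivAt (fun r => U r s (g r)) (U r s (K r (g r) + g')) r := by
  have hUr := (ContinuousLinearMap.restrictScalarsL ℂ E E ℝ ℝ).hasFDerivAt.comp_hasDerivAt r
    (hU.deriv_left r s)
  exact (hUr.clm_apply hg).congr_deriv (by simp)

end ComplexBanachAlgebra

section CStarAlgebra

variable {A : Type*} [CStarAlgebra A] {K : ℝ → A} {U : ℝ → ℝ → A}

namespace IsPropagator

theorem star_eq_swap (hU : IsPropagator K U) (hK : ∀ t, K t ∈ skewAdjoint A) (t s : ℝ) :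
    star (U t s) = U s t := by
  have hstar : ∀ t, star (K t) = -K t := fun t => skewAdjoint.mem_iff.1 (hK t)
  have hadj : IsPropagator K fun t s => star (U s t) :=
    { deriv_left := fun t s => (hU.deriv_right s t).star.congr_deriv (by simp [hstar])
      deriv_right := fun t s => (hU.deriv_left s t).star.congr_deriv (by simp [hstar])
      diag := fun s => by simp [hU.diag] }
  exact congrFun₂ (hadj.unique hU) s t

theorem mem_unitary (hU : IsPropagator K U) (hK : ∀ t, K t ∈ skewAdjoint A) (t s : ℝ) :
    U t s ∈ unitary A := by
  rw [Unitary.mem_iff, hU.star_eq_swap hK]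
  exact ⟨hU.mul_swap s t, hU.mul_swap t s⟩

theorem norm_mulLeftRight (hU : IsPropagator K U) (hK : ∀ t, K t ∈ skewAdjoint A) (t s : ℝ)
    (b : A) : ‖ContinuousLinearMap.mulLeftRight ℂ A (U t s) (U s t) b‖ = ‖b‖ := by
  rw [ContinuousLinearMap.mulLeftRight_apply,
    CStarRing.norm_mul_mem_unitary _ (hU.mem_unitary hK s t),
    CStarRing.norm_mem_unitary_mul _ (hU.mem_unitary hK t s)]

end IsPropagator

theorem norm_le_of_hasDerivAt_lie_add {J g R : ℝ → A} (hJ : Continuous J)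
    (hJs : ∀ t, J t ∈ skewAdjoint A) (s t : ℝ)
    (hg : ∀ r, HasDerivAt g (⁅J r, g r⁆ + R r) r) {β β' : ℝ → ℝ}
    (hβ : ∀ u, HasDerivAt β (β' u) u) (h0 : ‖g s‖ ≤ β 0)
    (h : ∀ r, |r - s| ≤ |t - s| → ‖R r‖ ≤ β' |r - s|) : ‖g t‖ ≤ β |t - s| := by
  obtain ⟨U, hU⟩ := exists_isPropagator hJ.neg
  have hnorm := hU.norm_mulLeftRight fun r => neg_mem (hJs r)
  -- In the frame that rotates with `J` only the inhomogeneity is left.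
  have hcancel : ∀ r, adCLM (-J r) (g r) + (⁅J r, g r⁆ + R r) = R r := fun r => by simp
  have hderiv := fun r => (hU.mulLeftRight.hasDerivAt_apply s (hg r)).congr_deriv
    (congrArg _ (hcancel r))
  have hle := norm_le_of_norm_deriv_le s t hderiv hβ (by rwa [hnorm])
    fun r hr => (hnorm r s (R r)).trans_le (h r hr)
  rwa [hnorm] at hle

theorem norm_lie_le_of_hasDerivAt_lie {J c : ℝ → A} (hJ : Continuous J)
    (hJs : ∀ t, J t ∈ skewAdjoint A) (a : A) (s t : ℝ) (hc : ∀ r, HasDerivAt c ⁅J r, c r⁆ r)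
    {β β' : ℝ → ℝ} (hβ : ∀ u, HasDerivAt β (β' u) u) (h0 : ‖⁅c s, a⁆‖ ≤ β 0)
    (h : ∀ r, |r - s| ≤ |t - s| → 2 * ‖c r‖ * ‖⁅J r, a⁆‖ ≤ β' |r - s|) :
    ‖⁅c t, a⁆‖ ≤ β |t - s| := by
  have hderiv : ∀ r, HasDerivAt (fun r => ⁅c r, a⁆) (⁅J r, ⁅c r, a⁆⁆ + -⁅c r, ⁅J r, a⁆⁆) r :=
    fun r => (((hc r).mul_const a).sub ((hc r).const_mul a)).congr_deriv (by
      simp only [Ring.lie_def]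
      noncomm_ring)
  refine norm_le_of_hasDerivAt_lie_add hJ hJs s t hderiv hβ h0 fun r hr => ?_
  rw [norm_neg]
  exact (norm_lie_le _ _).trans (h r hr)

end CStarAlgebra

/-! ### Locality in the CAR algebra -/

theorem mul_eq_map_mul_of_mem_adjoin {R A : Type*} [CommSemiring R] [Semiring A] [Algebra R A]
    {σ : A →ₐ[R] A} {c : A} {s : Set A} (h : ∀ g ∈ s, c * g = σ g * c) {b : A}
    (hb : b ∈ Algebra.adjoin R s) : c * b = σ b * c := by
  induction hb using Algebra.adjoin_induction with
  | mem g hg => exact h g hg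
  | algebraMap r => rw [AlgHom.commutes, Algebra.commutes]
  | add a b _ _ ha hb => rw [mul_add, ha, hb, map_add, add_mul]
  | mul a b _ _ ha hb => rw [← mul_assoc, ha, mul_assoc, hb, map_mul, mul_assoc]

section Locality

variable {d : ℕ} {X Y : Finset (Lattice d)}

theorem norm_parity (b : CAR d) : ‖parity d b‖ = ‖b‖ := StarAlgEquiv.norm_map _ b

theorem norm_translation (z : Lattice d) (b : CAR d) : ‖translation z b‖ = ‖b‖ :=
  StarAlgEquiv.norm_map _ b

theorem continuous_parity : Continuous (parity d) :=
  (AddMonoidHomClass.isometry_of_norm (parity d) norm_parity).continuous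

theorem continuous_translation (z : Lattice d) : Continuous (translation z) :=
  (AddMonoidHomClass.isometry_of_norm (translation z) (norm_translation z)).continuous

theorem topologicalClosure_adjoin_range_ann :
    (StarAlgebra.adjoin ℂ (Set.range (ann (d := d)))).topologicalClosure = ⊤ := by
  let ι : CAR d →⋆ₐ[ℂ] (Fock d →L[ℂ] Fock d) := (carSubalgebra d).subtype
  have hmap : (StarAlgebra.adjoin ℂ (Set.range ann)).map ι =
      StarAlgebra.adjoin ℂ (Set.range fockA) :=
    (StarAlgHom.map_adjoin ι _).trans (congrArg _ (Set.range_comp ι ann).symm)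
  refine top_unique fun b _ => closure_subtype.2 ?_
  exact closure_mono (congrArg SetLike.coe hmap).ge b.2

theorem parity_translation (z : Lattice d) (b : CAR d) :
    parity d (translation z b) = translation z (parity d b) := by
  let f := (translation z).trans (parity d)
  let g := (parity d).trans (translation z)
  have hle : StarAlgebra.adjoin ℂ (Set.range (ann (d := d))) ≤ StarAlgHom.equalizer f g := by
    refine StarAlgHom.adjoin_le_equalizer f g ?_
    rintro _ ⟨x, rfl⟩
    simp [f, g, translation_ann, parity_ann]
  have hclosed : IsClosed (StarAlgHom.equalizer f g : Set (CAR d)) :=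
    isClosed_eq (continuous_parity.comp (continuous_translation z))
      ((continuous_translation z).comp continuous_parity)
  exact StarSubalgebra.topologicalClosure_minimal hle hclosed
    (topologicalClosure_adjoin_range_ann.ge trivial)

theorem localAlg_mono (h : X ⊆ Y) : localAlg X ≤ localAlg Y :=
  StarAlgebra.adjoin_mono (Set.image_mono (Finset.coe_subset.2 h))

theorem translation_mem_localAlg (z : Lattice d) {L : ℝ} {b : CAR d} (hb : b ∈ localAlg (box L)) :
    translation z b ∈ localAlg (boxAt L z) := by
  have hle : localAlg (box L) ≤
      (localAlg (boxAt L z)).comap (translation z : CAR d →⋆ₐ[ℂ] CAR d) := by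
    refine StarAlgebra.adjoin_le ?_
    rintro _ ⟨x, hx, rfl⟩
    exact StarAlgebra.subset_adjoin ℂ _
      ⟨x + z, Finset.mem_image_of_mem _ hx, (translation_ann z x).symm⟩
  exact hle hb

theorem adjoin_range_ann_eq_iUnion_localAlg :
    (StarAlgebra.adjoin ℂ (Set.range (ann (d := d))) : Set (CAR d)) =
      ⋃ X : Finset (Lattice d), (localAlg X : Set (CAR d)) := by
  classical
  have hdir : Directed (· ≤ ·) (localAlg (d := d)) := Monotone.directed_le fun _ _ => localAlg_mono
  rw [← StarSubalgebra.coe_iSup_of_directed hdir]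
  refine congrArg SetLike.coe (le_antisymm (StarAlgebra.adjoin_le ?_) (iSup_le fun X => ?_))
  · rintro _ ⟨x, rfl⟩
    exact le_iSup (localAlg (d := d)) {x} (StarAlgebra.subset_adjoin ℂ _ ⟨x, by simp, rfl⟩)
  · exact StarAlgebra.adjoin_mono (Set.image_subset_range _ _)

theorem dense_iUnion_localAlg :
    Dense (⋃ X : Finset (Lattice d), (localAlg X : Set (CAR d))) := fun b => by
  rw [← adjoin_range_ann_eq_iUnion_localAlg]
  exact topologicalClosure_adjoin_range_ann.ge (Set.mem_univ b)

/-- The norm closure of the local algebra `𝒰_X`, in which the dynamics of the region `X` acts. -/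
noncomputable def closedLocalAlg (X : Finset (Lattice d)) : StarSubalgebra ℂ (CAR d) :=
  (localAlg X).topologicalClosure

/-- The algebra `𝒰⁺` of even elements. -/
noncomputable def evenSubalgebra (d : ℕ) : StarSubalgebra ℂ (CAR d) :=
  StarAlgHom.equalizer (parity d : CAR d →⋆ₐ[ℂ] CAR d) (StarAlgHom.id ℂ (CAR d))

/-- The even elements of the closed local algebra of `X`. They commute with everything localized
in a disjoint region. -/
noncomputable def evenLocalAlg (X : Finset (Lattice d)) : StarSubalgebra ℂ (CAR d) :=
  closedLocalAlg X ⊓ evenSubalgebra d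

theorem localAlg_le_closedLocalAlg (X : Finset (Lattice d)) : localAlg X ≤ closedLocalAlg X :=
  StarSubalgebra.le_topologicalClosure _

theorem isClosed_evenLocalAlg (X : Finset (Lattice d)) :
    IsClosed (evenLocalAlg X : Set (CAR d)) :=
  (StarSubalgebra.isClosed_topologicalClosure (localAlg X)).inter
    (isClosed_eq continuous_parity continuous_id)

theorem closedLocalAlg_mono (h : X ⊆ Y) : closedLocalAlg X ≤ closedLocalAlg Y :=
  StarSubalgebra.topologicalClosure_mono (localAlg_mono h)

theorem evenLocalAlg_mono (h : X ⊆ Y) : evenLocalAlg X ≤ evenLocalAlg Y :=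
  inf_le_inf_right _ (closedLocalAlg_mono h)

theorem evenLocalAlg_le_closedLocalAlg (X : Finset (Lattice d)) :
    evenLocalAlg X ≤ closedLocalAlg X :=
  inf_le_left

theorem mem_evenLocalAlg {b : CAR d} (hb : b ∈ localAlg X) (he : IsEven b) : b ∈ evenLocalAlg X :=
  ⟨localAlg_le_closedLocalAlg X hb, he⟩

theorem translation_mem_evenLocalAlg (z : Lattice d) {L : ℝ} {b : CAR d}
    (hb : b ∈ localAlg (box L)) (he : IsEven b) : translation z b ∈ evenLocalAlg (boxAt L z) :=
  mem_evenLocalAlg (translation_mem_localAlg z hb) ((parity_translation z b).trans (congrArg _ he))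

theorem ann_mul_eq_parity_mul {y : Lattice d} (hy : y ∉ X) {b : CAR d} (hb : b ∈ closedLocalAlg X) :
    ann y * b = parity d b * ann y := by
  have hclosed : IsClosed {b : CAR d | ann y * b = parity d b * ann y} :=
    isClosed_eq (by fun_prop) (continuous_parity.mul continuous_const)
  refine closure_minimal (fun b hb => ?_) hclosed hb
  have hgen : ∀ g ∈ ann '' (X : Set (Lattice d)) ∪ star (ann '' (X : Set (Lattice d))),
      ann y * g = parity d g * ann y := by
    rintro g (⟨x, -, rfl⟩ | ⟨x, hx, hxg⟩)
    · rw [parity_ann, neg_mul]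
      exact eq_neg_of_add_eq_zero_left (ann_mul_ann y x)
    · have hyx : y ≠ x := fun h => hy (h ▸ hx)
      rw [← star_star g, ← hxg, map_star, parity_ann, star_neg, neg_mul]
      exact eq_neg_of_add_eq_zero_left ((ann_mul_star_ann y x).trans (if_neg hyx))
  exact mul_eq_map_mul_of_mem_adjoin (σ := (parity d : CAR d →ₐ[ℂ] CAR d)) hgen hb

theorem commute_of_disjoint (h : Disjoint X Y) {a b : CAR d} (ha : a ∈ evenLocalAlg X)
    (hb : b ∈ closedLocalAlg Y) : Commute a b := by
  have hann : ∀ {c : CAR d} {y : Lattice d}, c ∈ evenLocalAlg X → y ∉ X → c * ann y = ann y * c :=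
    fun {c y} hc hy => by rw [ann_mul_eq_parity_mul hy hc.1, show parity d c = c from hc.2]
  have hle : localAlg Y ≤ StarSubalgebra.centralizer ℂ {a} := by
    refine StarAlgebra.adjoin_le ?_
    rintro _ ⟨y, hy, rfl⟩
    have hyX : y ∉ X := Finset.disjoint_right.1 h hy
    refine (StarSubalgebra.mem_centralizer_iff ℂ).2 ?_
    rintro _ rfl
    exact ⟨hann ha hyX, hann (star_mem ha) hyX⟩
  have hclosed : IsClosed (StarSubalgebra.centralizer ℂ {a} : Set (CAR d)) := by
    rw [StarSubalgebra.coe_centralizer]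
    exact Set.isClosed_centralizer _
  exact ((StarSubalgebra.mem_centralizer_iff ℂ).1
    (StarSubalgebra.topologicalClosure_minimal hle hclosed hb) a rfl).1

end Locality

/-! ### Decay functions and interactions -/

section Kernel

variable {d : ℕ}

theorem len_neg (x : Lattice d) : len (-x) = len x := by
  unfold len
  rw [← nnnorm_neg]
  congr 1
  ext i
  simp

namespace DecayFunction

variable (F : DecayFunction d)

/-- The translation-invariant kernel `𝐅(|x - y|)` of a decay function. -/
noncomputable def kernel (x y : Lattice d) : ℝ := F.toFun (len (x - y))

/-- The total weight `∑_x 𝐅(|x|)` of a decay function. -/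
noncomputable def mass : ℝ := ∑' x : Lattice d, F.toFun (len x)

theorem kernel_pos (x y : Lattice d) : 0 < F.kernel x y :=
  F.pos _

theorem kernel_comm (x y : Lattice d) : F.kernel x y = F.kernel y x := by
  rw [kernel, kernel, ← len_neg, neg_sub]

theorem mass_nonneg : 0 ≤ F.mass :=
  tsum_nonneg fun _ => (F.pos _).le

theorem summable_kernel (x : Lattice d) : Summable (F.kernel x) :=
  ((Equiv.subLeft x).summable_iff (f := fun x : Lattice d => F.toFun (len x))).2 F.summable

theorem sum_kernel_le_mass (x : Lattice d) (S : Finset (Lattice d)) :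
    ∑ z ∈ S, F.kernel x z ≤ F.mass :=
  ((F.summable_kernel x).sum_le_tsum S fun z _ => (F.kernel_pos x z).le).trans_eq
    ((Equiv.subLeft x).tsum_eq fun x : Lattice d => F.toFun (len x))

theorem sum_kernel_mul_kernel_le (x y : Lattice d) (S : Finset (Lattice d)) :
    ∑ z ∈ S, F.kernel x z * F.kernel z y ≤ F.D * F.kernel x y := by
  rw [← div_le_iff₀ (F.kernel_pos x y), Finset.sum_div, D,
    ← ENNReal.ofReal_le_iff_le_toReal F.convConst_lt_top.ne,
    ENNReal.ofReal_sum_of_nonneg fun z _ => div_nonneg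
      (mul_pos (F.kernel_pos x z) (F.kernel_pos z y)).le (F.kernel_pos x y).le]
  exact (ENNReal.sum_le_tsum S).trans (le_iSup₂_of_le x y le_rfl)

theorem D_pos : 0 < F.D := by
  have h := F.sum_kernel_mul_kernel_le 0 0 {0}
  rw [Finset.sum_singleton] at h
  exact (F.kernel_pos 0 0).trans_le (le_of_mul_le_mul_right h (F.kernel_pos 0 0))

/-- The kernel `δ_{x,y} + e 𝐅(|x - y|)` governing Lieb–Robinson bounds for pairs of sites; the
diagonal term accounts for the overlap of the two regions at time zero. -/
noncomputable def lrKernel (e : ℝ) (x y : Lattice d) : ℝ :=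
  (if x = y then 1 else 0) + e * F.kernel x y

variable {F} in
theorem lrKernel_nonneg {e : ℝ} (he : 0 ≤ e) (x y : Lattice d) : 0 ≤ F.lrKernel e x y :=
  add_nonneg (by split_ifs <;> norm_num) (mul_nonneg he (F.kernel_pos x y).le)

theorem lrKernel_comm (e : ℝ) (x y : Lattice d) : F.lrKernel e x y = F.lrKernel e y x := by
  simp only [lrKernel, F.kernel_comm x y, eq_comm]

theorem sum_kernel_mul_lrKernel_le {e : ℝ} (he : 0 ≤ e) (x y : Lattice d)
    (S : Finset (Lattice d)) :
    ∑ z ∈ S, F.kernel x z * F.lrKernel e z y ≤ (1 + F.D * e) * F.kernel x y := by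
  have diagonal : ∑ z ∈ S, F.kernel x z * (if z = y then 1 else 0) ≤ F.kernel x y := by
    simp only [mul_ite, mul_one, mul_zero, Finset.sum_ite_eq']
    split_ifs
    exacts [le_rfl, (F.kernel_pos x y).le]
  calc ∑ z ∈ S, F.kernel x z * F.lrKernel e z y
      = ∑ z ∈ S, F.kernel x z * (if z = y then 1 else 0) +
          e * ∑ z ∈ S, F.kernel x z * F.kernel z y := by
        simp only [lrKernel, mul_add, Finset.sum_add_distrib, Finset.mul_sum, mul_left_comm]
    _ ≤ F.kernel x y + e * (F.D * F.kernel x y) :=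
        add_le_add diagonal (mul_le_mul_of_nonneg_left (F.sum_kernel_mul_kernel_le x y S) he)
    _ = (1 + F.D * e) * F.kernel x y := by ring

/-- The function `(e^{2 𝐃 α u} - 1) / 𝐃`, which solves `g' = 2 α (1 + 𝐃 g)`, `g(0) = 0`. -/
noncomputable def growth (α u : ℝ) : ℝ :=
  (Real.exp (2 * F.D * α * u) - 1) / F.D

theorem growth_zero (α : ℝ) : F.growth α 0 = 0 := by
  simp [growth]

theorem one_add_D_mul_growth (α u : ℝ) :
    1 + F.D * F.growth α u = Real.exp (2 * F.D * α * u) := by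
  rw [growth, mul_div_cancel₀ _ F.D_pos.ne']
  ring

theorem growth_nonneg {α u : ℝ} (hα : 0 ≤ α) (hu : 0 ≤ u) : 0 ≤ F.growth α u := by
  have := F.D_pos
  exact div_nonneg (sub_nonneg.2 (Real.one_le_exp (by positivity))) this.le

theorem hasDerivAt_growth (α u : ℝ) :
    HasDerivAt (F.growth α) (2 * α * (1 + F.D * F.growth α u)) u := by
  have h : HasDerivAt (fun u : ℝ => 2 * F.D * α * u) (2 * F.D * α) u := by
    simpa using (hasDerivAt_id u).const_mul (2 * F.D * α)
  refine ((h.exp.sub_const 1).div_const F.D).congr_deriv ?_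
  rw [one_add_D_mul_growth]
  have := F.D_pos.ne'
  field_simp

end DecayFunction

namespace Interaction

variable {Φ : Interaction d} {F : DecayFunction d} {α : ℝ≥0}

theorem sum_norm_le (hΦ : Φ.normW F ≤ α) (x y : Lattice d) (𝒵 : Finset (Finset (Lattice d)))
    (h𝒵 : ∀ Z ∈ 𝒵, x ∈ Z ∧ y ∈ Z) : ∑ Z ∈ 𝒵, ‖Φ.toFun Z‖ ≤ α * F.kernel x y := by
  rw [← div_le_iff₀ (F.kernel_pos x y), Finset.sum_div, ← ENNReal.coe_toReal,
    ← ENNReal.ofReal_le_iff_le_toReal ENNReal.coe_ne_top,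
    ENNReal.ofReal_sum_of_nonneg fun Z _ => div_nonneg (norm_nonneg _) (F.kernel_pos x y).le,
    ← Finset.sum_subtype_of_mem _ h𝒵]
  exact (ENNReal.sum_le_tsum _).trans ((le_iSup₂_of_le x y le_rfl).trans hΦ)

theorem sum_norm_mul_sum_le (hΦ : Φ.normW F ≤ α) {X Λ : Finset (Lattice d)}
    {𝒵 : Finset (Finset (Lattice d))} (hΛ : ∀ Z ∈ 𝒵, Z ⊆ Λ) (hX : ∀ Z ∈ 𝒵, ¬ Disjoint Z X)
    {g : Lattice d → ℝ} (hg : ∀ z, 0 ≤ g z) :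
    ∑ Z ∈ 𝒵, ‖Φ.toFun Z‖ * ∑ z ∈ Z, g z ≤ α * ∑ x ∈ X, ∑ z ∈ Λ, F.kernel x z * g z := by
  have le_sum_meeting_points (Z) (hZ : Z ∈ 𝒵) :
      ‖Φ.toFun Z‖ * ∑ z ∈ Z, g z ≤
        ∑ x ∈ X, ∑ z ∈ Λ, if x ∈ Z ∧ z ∈ Z then ‖Φ.toFun Z‖ * g z else 0 := by
    obtain ⟨x, hxZ, hxX⟩ := Finset.not_disjoint_iff.1 (hX Z hZ)
    refine le_trans (le_of_eq ?_) (Finset.single_le_sum (fun x _ => Finset.sum_nonneg fun z _ =>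
      ite_nonneg (mul_nonneg (norm_nonneg _) (hg z)) le_rfl) hxX)
    simp only [hxZ, true_and]
    rw [← Finset.sum_filter, Finset.filter_mem_eq_inter, Finset.inter_eq_right.2 (hΛ Z hZ),
      Finset.mul_sum]
  calc ∑ Z ∈ 𝒵, ‖Φ.toFun Z‖ * ∑ z ∈ Z, g z
      ≤ ∑ Z ∈ 𝒵, ∑ x ∈ X, ∑ z ∈ Λ, if x ∈ Z ∧ z ∈ Z then ‖Φ.toFun Z‖ * g z else 0 :=
        Finset.sum_le_sum le_sum_meeting_points
    _ = ∑ x ∈ X, ∑ z ∈ Λ, (∑ Z ∈ 𝒵 with x ∈ Z ∧ z ∈ Z, ‖Φ.toFun Z‖) * g z := by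
        simp only [Finset.sum_mul, Finset.sum_filter, ite_mul, zero_mul]
        rw [Finset.sum_comm]
        exact Finset.sum_congr rfl fun x _ => Finset.sum_comm
    _ ≤ ∑ x ∈ X, ∑ z ∈ Λ, (α * F.kernel x z) * g z :=
        Finset.sum_le_sum fun x _ => Finset.sum_le_sum fun z _ => mul_le_mul_of_nonneg_right
          (sum_norm_le hΦ x z _ fun Z hZ => (Finset.mem_filter.1 hZ).2) (hg z)
    _ = α * ∑ x ∈ X, ∑ z ∈ Λ, F.kernel x z * g z := by simp only [Finset.mul_sum, mul_assoc]

end Interaction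

end Kernel

/-! ### Finite-volume dynamics -/

section FiniteVolume

variable {d : ℕ}

theorem Interaction.mem_evenLocalAlg (Φ : Interaction d) {Z X : Finset (Lattice d)} (h : Z ⊆ X) :
    Φ.toFun Z ∈ evenLocalAlg X :=
  evenLocalAlg_mono h (FermiLattice.mem_evenLocalAlg (Φ.mem_localAlg Z) (Φ.isEven Z))

theorem Potential.mem_evenLocalAlg (V : Potential d) {x : Lattice d} {X : Finset (Lattice d)}
    (h : x ∈ X) : V.toFun x ∈ evenLocalAlg X :=
  evenLocalAlg_mono (Finset.singleton_subset_iff.2 h)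
    (FermiLattice.mem_evenLocalAlg (V.mem_localAlg x) (V.isEven x))

theorem I_smul_mem_skewAdjoint {a : CAR d} (ha : IsSelfAdjoint a) :
    Complex.I • a ∈ skewAdjoint (CAR d) :=
  ha.smul_mem_skewAdjoint (skewAdjoint.mem_iff.2 Complex.conj_I)

/-- A non-autonomous system of fermions on the lattice: a time-dependent interaction and a
time-dependent potential, both continuous in time term by term. -/
structure FermiSystem (d : ℕ) where
  interaction : ℝ → Interaction d
  potential : ℝ → Potential d
  continuous_interaction : ∀ Z, Continuous fun t => (interaction t).toFun Z
  continuous_potential : ∀ x, Continuous fun t => (potential t).toFun x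

namespace FermiSystem

variable (S : FermiSystem d)

/-- The skew-adjoint element `i (∑_{Z ∈ 𝒵} Ψ_Z + ∑_{x ∈ Y} V_x)` collecting the interaction terms
of the regions in `𝒵` and the potential of the sites in `Y`. The Hamiltonian of a region `Λ`
corresponds to `𝒵 = Λ.powerset`, `Y = Λ`. -/
noncomputable def generator (𝒵 : Finset (Finset (Lattice d))) (Y : Finset (Lattice d)) (t : ℝ) :
    CAR d :=
  Complex.I • (∑ Z ∈ 𝒵, (S.interaction t).toFun Z + ∑ x ∈ Y, (S.potential t).toFun x)

section Generator

variable (𝒵 : Finset (Finset (Lattice d))) (Y : Finset (Lattice d))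

theorem continuous_generator : Continuous (S.generator 𝒵 Y) :=
  ((continuous_finsetSum _ fun Z _ => S.continuous_interaction Z).add
    (continuous_finsetSum _ fun x _ => S.continuous_potential x)).const_smul Complex.I

theorem generator_mem_skewAdjoint (t : ℝ) : S.generator 𝒵 Y t ∈ skewAdjoint (CAR d) :=
  I_smul_mem_skewAdjoint ((isSelfAdjoint_sum _ fun _ _ => (S.interaction t).isSelfAdjoint _).add
    (isSelfAdjoint_sum _ fun _ _ => (S.potential t).isSelfAdjoint _))

theorem generator_mem_evenLocalAlg {𝒵 : Finset (Finset (Lattice d))} {X Y : Finset (Lattice d)}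
    (h𝒵 : ∀ Z ∈ 𝒵, Z ⊆ X) (hY : Y ⊆ X) (t : ℝ) : S.generator 𝒵 Y t ∈ evenLocalAlg X :=
  (evenLocalAlg X).smul_mem (add_mem
    (sum_mem fun Z hZ => (S.interaction t).mem_evenLocalAlg (h𝒵 Z hZ))
    (sum_mem fun _ hx => (S.potential t).mem_evenLocalAlg (hY hx))) Complex.I

theorem generator_eq_add (t : ℝ) :
    S.generator 𝒵 Y t = S.generator 𝒵 ∅ t + S.generator ∅ Y t := by
  simp [generator]

theorem adCLM_generator (t : ℝ) : adCLM (S.generator 𝒵 Y t) = Complex.I •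
    (∑ Z ∈ 𝒵, adCLM ((S.interaction t).toFun Z) + ∑ x ∈ Y, adCLM ((S.potential t).toFun x)) := by
  rw [generator, map_smul, map_add, map_sum, map_sum]

theorem derivation_eq_adCLM (t : ℝ) (L : ℝ≥0) :
    derivation (S.interaction t) (S.potential t) L =
      adCLM (S.generator (box (L : ℝ)).powerset (box (L : ℝ)) t) := by
  rw [adCLM_generator, smul_add]
  rfl

open Classical in
theorem lie_generator_eq_lie_generator_meeting {X : Finset (Lattice d)} {b : CAR d}
    (hb : b ∈ closedLocalAlg X) (t : ℝ) :
    ⁅S.generator 𝒵 Y t, b⁆ = ⁅S.generator {Z ∈ 𝒵 | ¬ Disjoint Z X} (Y ∩ X) t, b⁆ := by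
  have lie_eq_zero {Z : Finset (Lattice d)} {a : CAR d} (ha : a ∈ evenLocalAlg Z)
      (hZ : Disjoint Z X) : adCLM a b = 0 := (commute_of_disjoint hZ ha hb).lie_eq
  simp only [← adCLM_apply, adCLM_generator, smul_apply, add_apply, sum_apply]
  rw [Finset.sum_filter_of_ne fun Z _ => mt (lie_eq_zero ((S.interaction t).mem_evenLocalAlg
    subset_rfl)), Finset.sum_subset Finset.inter_subset_left fun x hxY hx => ?_]
  exact lie_eq_zero ((S.potential t).mem_evenLocalAlg (Finset.mem_singleton_self x))
    (Finset.disjoint_singleton_left.2 fun hxX => hx (Finset.mem_inter.2 ⟨hxY, hxX⟩))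

theorem norm_lie_map_generator_le (φ : CAR d →L[ℂ] CAR d) (a : CAR d) (t : ℝ) :
    ‖⁅φ (S.generator 𝒵 ∅ t), a⁆‖ ≤ ∑ Z ∈ 𝒵, ‖⁅φ ((S.interaction t).toFun Z), a⁆‖ := by
  have hsum : ⁅φ (S.generator 𝒵 ∅ t), a⁆ =
      Complex.I • ∑ Z ∈ 𝒵, ⁅φ ((S.interaction t).toFun Z), a⁆ := by
    simp only [← adCLM_apply, generator, Finset.sum_empty, add_zero, map_smul, map_sum,
      smul_apply, sum_apply]
  rw [hsum, norm_smul, Complex.norm_I, one_mul]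
  exact norm_sum_le _ _

end Generator

section Flow

variable (𝒵 : Finset (Finset (Lattice d))) (Y : Finset (Lattice d))

/-- The unitary propagator generated by `S.generator 𝒵 Y`. -/
noncomputable def propagator : ℝ → ℝ → CAR d :=
  (exists_isPropagator (S.continuous_generator 𝒵 Y)).choose

theorem isPropagator_propagator : IsPropagator (S.generator 𝒵 Y) (S.propagator 𝒵 Y) :=
  (exists_isPropagator (S.continuous_generator 𝒵 Y)).choose_spec

theorem propagator_mem_evenLocalAlg {𝒵 : Finset (Finset (Lattice d))} {X Y : Finset (Lattice d)}
    (h𝒵 : ∀ Z ∈ 𝒵, Z ⊆ X) (hY : Y ⊆ X) (t s : ℝ) : S.propagator 𝒵 Y t s ∈ evenLocalAlg X :=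
  (S.isPropagator_propagator 𝒵 Y).mem_subalgebra
    ((evenLocalAlg X).toSubalgebra.restrictScalars ℝ) (isClosed_evenLocalAlg X)
    (S.continuous_generator 𝒵 Y) (S.generator_mem_evenLocalAlg h𝒵 hY) t s

/-- The Heisenberg evolution `b ↦ U_{t,s} b U_{t,s}*` with `U` the propagator of
`S.generator 𝒵 Y`. It is written with `U_{s,t}` in place of `U_{t,s}*`. -/
noncomputable def flow (t s : ℝ) : CAR d →L[ℂ] CAR d :=
  ContinuousLinearMap.mulLeftRight ℂ (CAR d) (S.propagator 𝒵 Y t s) (S.propagator 𝒵 Y s t)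

theorem flow_apply (t s : ℝ) (b : CAR d) :
    S.flow 𝒵 Y t s b = S.propagator 𝒵 Y t s * b * S.propagator 𝒵 Y s t := rfl

theorem isPropagator_flow :
    IsPropagator (fun t => adCLM (S.generator 𝒵 Y t)) (S.flow 𝒵 Y) :=
  (S.isPropagator_propagator 𝒵 Y).mulLeftRight

theorem continuous_flow_apply (s : ℝ) {g : ℝ → CAR d} (hg : Continuous g) :
    Continuous fun r => S.flow 𝒵 Y r s (g r) :=
  Continuous.clm_apply (continuous_iff_continuousAt.2 fun r =>
    ((S.isPropagator_flow 𝒵 Y).deriv_left r s).continuousAt) hg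

theorem hasDerivAt_flow_right (t r : ℝ) (b : CAR d) :
    HasDerivAt (fun r => S.flow 𝒵 Y t r b) (-⁅S.generator 𝒵 Y r, S.flow 𝒵 Y t r b⁆) r := by
  have h := (ContinuousLinearMap.restrictScalarsL ℂ (CAR d) (CAR d) ℝ ℝ).hasFDerivAt.comp_hasDerivAt
    r ((S.isPropagator_flow 𝒵 Y).deriv_right t r)
  exact (h.clm_apply (hasDerivAt_const r b)).congr_deriv (by simp)

theorem norm_flow (t s : ℝ) (b : CAR d) : ‖S.flow 𝒵 Y t s b‖ = ‖b‖ :=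
  (S.isPropagator_propagator 𝒵 Y).norm_mulLeftRight (S.generator_mem_skewAdjoint 𝒵 Y) t s b

theorem flow_self (s : ℝ) (b : CAR d) : S.flow 𝒵 Y s s b = b := by
  rw [(S.isPropagator_flow 𝒵 Y).diag, one_apply_eq_self]

theorem flow_mul (t s : ℝ) (a b : CAR d) :
    S.flow 𝒵 Y t s (a * b) = S.flow 𝒵 Y t s a * S.flow 𝒵 Y t s b := by
  simp only [flow_apply, mul_assoc]
  rw [← mul_assoc (S.propagator 𝒵 Y s t), (S.isPropagator_propagator 𝒵 Y).mul_swap, one_mul]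

theorem flow_lie (t s : ℝ) (a b : CAR d) :
    S.flow 𝒵 Y t s ⁅a, b⁆ = ⁅S.flow 𝒵 Y t s a, S.flow 𝒵 Y t s b⁆ := by
  rw [Ring.lie_def, Ring.lie_def, map_sub, flow_mul, flow_mul]

theorem flow_star (t s : ℝ) (b : CAR d) : S.flow 𝒵 Y t s (star b) = star (S.flow 𝒵 Y t s b) := by
  have hstar := (S.isPropagator_propagator 𝒵 Y).star_eq_swap (S.generator_mem_skewAdjoint 𝒵 Y)
  simp only [flow_apply, star_mul, hstar, mul_assoc]

theorem flow_mem {𝒵 : Finset (Finset (Lattice d))} {X Y : Finset (Lattice d)}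
    (h𝒵 : ∀ Z ∈ 𝒵, Z ⊆ X) (hY : Y ⊆ X) {𝒜 : StarSubalgebra ℂ (CAR d)} (h𝒜 : evenLocalAlg X ≤ 𝒜)
    (t s : ℝ) {b : CAR d} (hb : b ∈ 𝒜) : S.flow 𝒵 Y t s b ∈ 𝒜 :=
  mul_mem (mul_mem (h𝒜 (S.propagator_mem_evenLocalAlg h𝒵 hY t s)) hb)
    (h𝒜 (S.propagator_mem_evenLocalAlg h𝒵 hY s t))

end Flow

/-- The dynamics of the finite region `Λ`. -/
noncomputable abbrev dynamics (Λ : Finset (Lattice d)) (t s : ℝ) : CAR d →L[ℂ] CAR d :=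
  S.flow Λ.powerset Λ t s

theorem dynamics_mem {Λ : Finset (Lattice d)} {𝒜 : StarSubalgebra ℂ (CAR d)}
    (h𝒜 : evenLocalAlg Λ ≤ 𝒜) (t s : ℝ) {b : CAR d} (hb : b ∈ 𝒜) : S.dynamics Λ t s b ∈ 𝒜 :=
  S.flow_mem (fun _ => Finset.mem_powerset.1) subset_rfl h𝒜 t s hb

theorem isFiniteVolumeDynamics_iff_isPropagator {L : ℝ≥0} {τ : ℝ → ℝ → CAR d →L[ℂ] CAR d} :
    IsFiniteVolumeDynamics S.interaction S.potential L τ ↔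
      IsPropagator (fun t => derivation (S.interaction t) (S.potential t) L) τ :=
  ⟨fun h => ⟨h.deriv_left, h.deriv_right, h.diag⟩, fun h => ⟨h.deriv_left, h.deriv_right, h.diag⟩⟩

theorem isFiniteVolumeDynamics_iff_eq_dynamics {L : ℝ≥0} {τ : ℝ → ℝ → CAR d →L[ℂ] CAR d} :
    IsFiniteVolumeDynamics S.interaction S.potential L τ ↔ τ = S.dynamics (box (L : ℝ)) := by
  simp only [isFiniteVolumeDynamics_iff_isPropagator, derivation_eq_adCLM]
  exact ⟨fun h => h.unique (S.isPropagator_flow _ _), fun h => h ▸ S.isPropagator_flow _ _⟩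

end FermiSystem

end FiniteVolume

/-! ### Lieb–Robinson bounds in finite volume -/

section LiebRobinson

variable {d : ℕ}

namespace DecayFunction

variable (F : DecayFunction d) (α : ℝ≥0) (Y : Finset (Lattice d)) (N : ℕ)

/-- The contribution of the site `z` to the bound on `‖⁅τ_{t,s}(B), A⁆‖`, with `A` localized in `Y`
and `u = |t - s|`, that results from `N` iterations of Duhamel's formula. The last term is the
trivial bound on the error after `N` steps. -/
noncomputable def duhamelBound (u : ℝ) (z : Lattice d) : ℝ :=
  ∑ y ∈ Y, F.lrKernel (F.growth α u) z y + (2 * α * F.mass * u) ^ N / N.factorial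

variable {F α Y N}

theorem sum_lrKernel_nonneg {u : ℝ} (hu : 0 ≤ u) (z : Lattice d) :
    0 ≤ ∑ y ∈ Y, F.lrKernel (F.growth α u) z y :=
  Finset.sum_nonneg fun y _ => lrKernel_nonneg (F.growth_nonneg α.coe_nonneg hu) z y

theorem duhamelBound_nonneg {u : ℝ} (hu : 0 ≤ u) (z : Lattice d) :
    0 ≤ F.duhamelBound α Y N u z := by
  have := F.mass_nonneg
  exact add_nonneg (sum_lrKernel_nonneg hu z) (by positivity)

theorem one_le_duhamelBound_zero_iter {u : ℝ} (hu : 0 ≤ u) (z : Lattice d) :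
    1 ≤ F.duhamelBound α Y 0 u z := by
  simpa [duhamelBound] using sum_lrKernel_nonneg hu z

theorem one_le_duhamelBound_of_mem {z : Lattice d} (hz : z ∈ Y) :
    1 ≤ F.duhamelBound α Y N 0 z := by
  have hdiag : F.lrKernel (F.growth α 0) z z ≤ ∑ y ∈ Y, F.lrKernel (F.growth α 0) z y :=
    Finset.single_le_sum
      (fun y _ => lrKernel_nonneg (F.growth_nonneg α.coe_nonneg le_rfl) z y) hz
  have hone : F.lrKernel (F.growth α 0) z z = 1 := by simp [lrKernel, growth_zero]
  have hrest : (0 : ℝ) ≤ (2 * α * F.mass * 0) ^ N / N.factorial := by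
    rw [mul_zero]
    positivity
  exact hone.ge.trans (hdiag.trans (le_add_of_nonneg_right hrest))

variable (F α Y N) in
theorem hasDerivAt_duhamelBound_succ (u : ℝ) (x : Lattice d) :
    HasDerivAt (fun u => F.duhamelBound α Y (N + 1) u x)
      (2 * α * (∑ y ∈ Y, (1 + F.D * F.growth α u) * F.kernel x y +
        F.mass * ((2 * α * F.mass * u) ^ N / N.factorial))) u := by
  refine ((HasDerivAt.fun_sum fun y _ => ((F.hasDerivAt_growth α u).mul_const
    (F.kernel x y)).const_add _).add
      (hasDerivAt_mul_pow_div_factorial (2 * α * F.mass) N u)).congr_deriv ?_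
  simp only [mul_assoc, ← Finset.mul_sum, ← mul_add]

theorem sum_kernel_mul_duhamelBound_le {u : ℝ} (hu : 0 ≤ u) (x : Lattice d)
    (Λ : Finset (Lattice d)) :
    ∑ z ∈ Λ, F.kernel x z * F.duhamelBound α Y N u z ≤
      ∑ y ∈ Y, (1 + F.D * F.growth α u) * F.kernel x y +
        F.mass * ((2 * α * F.mass * u) ^ N / N.factorial) := by
  have := F.mass_nonneg
  simp only [duhamelBound, mul_add, Finset.sum_add_distrib, Finset.mul_sum]
  rw [Finset.sum_comm, ← Finset.sum_mul]
  exact add_le_add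
    (Finset.sum_le_sum fun y _ =>
      F.sum_kernel_mul_lrKernel_le (F.growth_nonneg α.coe_nonneg hu) x y Λ)
    (mul_le_mul_of_nonneg_right (F.sum_kernel_le_mass x Λ) (by positivity))

variable (F α Y) in
theorem tendsto_duhamelBound (u : ℝ) (x : Lattice d) :
    Filter.Tendsto (fun N => F.duhamelBound α Y N u x) Filter.atTop
      (nhds (∑ y ∈ Y, F.lrKernel (F.growth α u) x y)) := by
  simpa only [duhamelBound, add_zero] using
    (FloorSemiring.tendsto_pow_div_factorial_atTop (2 * α * F.mass * u)).const_add
      (∑ y ∈ Y, F.lrKernel (F.growth α u) x y)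

end DecayFunction

namespace FermiSystem

variable (S : FermiSystem d) {Λ Λ' X Y : Finset (Lattice d)} {A B : CAR d}

open Classical in
theorem norm_lie_dynamics_le_of_sum_norm_lie_le (hB : B ∈ closedLocalAlg X) (A : CAR d) (s t : ℝ)
    {β β' : ℝ → ℝ} (hβ : ∀ u, HasDerivAt β (β' u) u)
    (h0 : ∀ b ∈ closedLocalAlg X, ‖b‖ = ‖B‖ → ‖⁅b, A⁆‖ ≤ β 0)
    (h : ∀ r, 2 * ‖B‖ * ∑ Z ∈ Λ.powerset with ¬ Disjoint Z X,
      ‖⁅S.dynamics Λ r s ((S.interaction r).toFun Z), A⁆‖ ≤ β' |r - s|) :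
    ‖⁅S.dynamics Λ t s B, A⁆‖ ≤ β |t - s| := by
  set 𝒵 := {Z ∈ Λ.powerset | ¬ Disjoint Z X}
  -- The potential is unbounded in the volume; inside `X` it is removed by rotating `B` with it.
  set b : ℝ → CAR d := fun r => S.flow ∅ (Λ ∩ X) t r B
  set J : ℝ → CAR d := fun r => S.dynamics Λ r s (S.generator 𝒵 ∅ r)
  have hbX : ∀ r, b r ∈ closedLocalAlg X := fun r =>
    S.flow_mem (by simp) Finset.inter_subset_right (evenLocalAlg_le_closedLocalAlg X) t r hB
  have hb : ∀ r, HasDerivAt b (-⁅S.generator ∅ (Λ ∩ X) r, b r⁆) r := fun r =>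
    S.hasDerivAt_flow_right ∅ (Λ ∩ X) t r B
  have hJ : Continuous J := S.continuous_flow_apply _ _ s (S.continuous_generator 𝒵 ∅)
  have hJs : ∀ r, J r ∈ skewAdjoint (CAR d) := fun r => by
    rw [skewAdjoint.mem_iff, ← flow_star,
      skewAdjoint.mem_iff.1 (S.generator_mem_skewAdjoint 𝒵 ∅ r), map_neg]
  have hlie : ∀ r, adCLM (S.generator Λ.powerset Λ r) (b r) + -⁅S.generator ∅ (Λ ∩ X) r, b r⁆ =
      ⁅S.generator 𝒵 ∅ r, b r⁆ := fun r => by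
    rw [adCLM_apply, S.lie_generator_eq_lie_generator_meeting _ _ (hbX r), generator_eq_add,
      ← adCLM_apply, ← adCLM_apply, map_add, add_apply, add_neg_cancel_right, adCLM_apply]
  have hc : ∀ r, HasDerivAt (fun r => S.dynamics Λ r s (b r)) ⁅J r, S.dynamics Λ r s (b r)⁆ r :=
    fun r => ((S.isPropagator_flow _ _).hasDerivAt_apply s (hb r)).congr_deriv (by
      rw [hlie, flow_lie])
  have key := norm_lie_le_of_hasDerivAt_lie hJ hJs A s t hc hβ ?_ fun r _ => ?_
  · simpa only [b, flow_self] using key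
  · rw [flow_self]
    exact h0 _ (hbX s) (S.norm_flow ∅ (Λ ∩ X) t s B)
  · rw [S.norm_flow, S.norm_flow]
    exact (mul_le_mul_of_nonneg_left (S.norm_lie_map_generator_le 𝒵 _ A r)
      (by positivity)).trans (h r)

variable {S} {F : DecayFunction d} {α : ℝ≥0}

theorem norm_lie_le_duhamelBound_zero (hA : A ∈ evenLocalAlg Y) (hB : B ∈ closedLocalAlg X)
    (N : ℕ) : ‖⁅B, A⁆‖ ≤ 2 * ‖A‖ * ‖B‖ * ∑ x ∈ X, F.duhamelBound α Y N 0 x := by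
  have hnonneg : ∀ x, 0 ≤ F.duhamelBound α Y N 0 x := DecayFunction.duhamelBound_nonneg le_rfl
  by_cases hXY : Disjoint X Y
  · rw [(commute_of_disjoint hXY.symm hA hB).symm.lie_eq, norm_zero]
    exact mul_nonneg (by positivity) (Finset.sum_nonneg fun x _ => hnonneg x)
  · obtain ⟨x, hxX, hxY⟩ := Finset.not_disjoint_iff.1 hXY
    have hone : 1 ≤ ∑ x ∈ X, F.duhamelBound α Y N 0 x :=
      (DecayFunction.one_le_duhamelBound_of_mem hxY).trans
        (Finset.single_le_sum (fun x _ => hnonneg x) hxX)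
    rw [mul_right_comm 2 ‖A‖ ‖B‖]
    exact (norm_lie_le B A).trans (le_mul_of_one_le_right (by positivity) hone)

theorem norm_lie_dynamics_le_duhamelBound_zero_iter (hA : A ∈ evenLocalAlg Y)
    (hB : B ∈ closedLocalAlg X) (t s : ℝ) :
    ‖⁅S.dynamics Λ t s B, A⁆‖ ≤ 2 * ‖A‖ * ‖B‖ * ∑ x ∈ X, F.duhamelBound α Y 0 |t - s| x := by
  classical
  rcases X.eq_empty_or_nonempty with rfl | ⟨x, hx⟩
  · have h := S.norm_lie_dynamics_le_of_sum_norm_lie_le (Λ := Λ) hB A s t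
      (fun u => hasDerivAt_const u (0 : ℝ))
      (fun b hb _ => by
        rw [(commute_of_disjoint (Finset.disjoint_empty_right Y) hA hb).symm.lie_eq, norm_zero])
      (fun r => by simp)
    simpa using h
  · have hone : 1 ≤ ∑ x ∈ X, F.duhamelBound α Y 0 |t - s| x :=
      (DecayFunction.one_le_duhamelBound_zero_iter (abs_nonneg _) x).trans (Finset.single_le_sum
        (fun x _ => DecayFunction.duhamelBound_nonneg (abs_nonneg _) x) hx)
    refine (norm_lie_le _ A).trans ?_
    rw [S.norm_flow, mul_right_comm 2 ‖A‖ ‖B‖]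
    exact le_mul_of_one_le_right (by positivity) hone

open Classical in
theorem sum_norm_mul_sum_duhamelBound_le (hα : ∀ t, (S.interaction t).normW F ≤ α)
    (Λ X Y : Finset (Lattice d)) (N : ℕ) {u : ℝ} (hu : 0 ≤ u) (r : ℝ) :
    ∑ Z ∈ Λ.powerset with ¬ Disjoint Z X,
        ‖(S.interaction r).toFun Z‖ * ∑ z ∈ Z, F.duhamelBound α Y N u z ≤
      α * ∑ x ∈ X, (∑ y ∈ Y, (1 + F.D * F.growth α u) * F.kernel x y +
        F.mass * ((2 * α * F.mass * u) ^ N / N.factorial)) :=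
  (Interaction.sum_norm_mul_sum_le (hα r)
    (fun _ hZ => Finset.mem_powerset.1 (Finset.mem_filter.1 hZ).1)
    (fun _ hZ => (Finset.mem_filter.1 hZ).2) (DecayFunction.duhamelBound_nonneg hu)).trans
    (mul_le_mul_of_nonneg_left (Finset.sum_le_sum fun x _ =>
      DecayFunction.sum_kernel_mul_duhamelBound_le hu x Λ) α.coe_nonneg)

theorem norm_lie_dynamics_le_duhamelBound (hα : ∀ t, (S.interaction t).normW F ≤ α)
    (hA : A ∈ evenLocalAlg Y) (s : ℝ) (N : ℕ) (hB : B ∈ closedLocalAlg X) (t : ℝ) :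
    ‖⁅S.dynamics Λ t s B, A⁆‖ ≤ 2 * ‖A‖ * ‖B‖ * ∑ x ∈ X, F.duhamelBound α Y N |t - s| x := by
  classical
  induction N generalizing X B t with
  | zero => exact norm_lie_dynamics_le_duhamelBound_zero_iter hA hB t s
  | succ N ih =>
    refine S.norm_lie_dynamics_le_of_sum_norm_lie_le hB A s t
      (fun u => (HasDerivAt.fun_sum fun x _ =>
        F.hasDerivAt_duhamelBound_succ α Y N u x).const_mul (2 * ‖A‖ * ‖B‖))
      (fun b hb hbB => hbB ▸ norm_lie_le_duhamelBound_zero hA hb (N + 1)) fun r => ?_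
    calc 2 * ‖B‖ * ∑ Z ∈ Λ.powerset with ¬ Disjoint Z X,
          ‖⁅S.dynamics Λ r s ((S.interaction r).toFun Z), A⁆‖
        ≤ 2 * ‖B‖ * ∑ Z ∈ Λ.powerset with ¬ Disjoint Z X, 2 * ‖A‖ *
            ‖(S.interaction r).toFun Z‖ * ∑ z ∈ Z, F.duhamelBound α Y N |r - s| z :=
          mul_le_mul_of_nonneg_left (Finset.sum_le_sum fun Z _ =>
            ih ((S.interaction r).mem_evenLocalAlg subset_rfl).1 r) (by positivity)
      _ = 2 * ‖A‖ * ‖B‖ * (2 * ∑ Z ∈ Λ.powerset with ¬ Disjoint Z X,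
            ‖(S.interaction r).toFun Z‖ * ∑ z ∈ Z, F.duhamelBound α Y N |r - s| z) := by
          simp only [mul_assoc, ← Finset.mul_sum]
          ring
      _ ≤ _ := by
          rw [← Finset.mul_sum, mul_assoc 2 (α : ℝ)]
          gcongr
          exact sum_norm_mul_sum_duhamelBound_le hα Λ X Y N (abs_nonneg _) r

theorem norm_lie_dynamics_le_lrKernel (hα : ∀ t, (S.interaction t).normW F ≤ α)
    (hA : A ∈ evenLocalAlg Y) (hB : B ∈ closedLocalAlg X) (t s : ℝ) :
    ‖⁅S.dynamics Λ t s B, A⁆‖ ≤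
      2 * ‖A‖ * ‖B‖ * ∑ x ∈ X, ∑ y ∈ Y, F.lrKernel (F.growth α |t - s|) x y :=
  ge_of_tendsto' ((tendsto_finsetSum X fun x _ =>
    F.tendsto_duhamelBound α Y |t - s| x).const_mul (2 * ‖A‖ * ‖B‖))
    fun N => norm_lie_dynamics_le_duhamelBound hα hA s N hB t

open Classical in
variable (S) in
theorem hasDerivAt_dynamics_dynamics (hΛ : Λ ⊆ Λ') (hB : B ∈ closedLocalAlg Λ) (t s r : ℝ) :
    HasDerivAt (fun r => S.dynamics Λ' r s (S.dynamics Λ t r B))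
      (S.dynamics Λ' r s ⁅S.generator {Z ∈ Λ'.powerset | ¬ Z ⊆ Λ} ∅ r, S.dynamics Λ t r B⁆) r := by
  refine ((S.isPropagator_flow _ _).hasDerivAt_apply s
    (S.hasDerivAt_flow_right _ _ t r B)).congr_deriv (congrArg _ ?_)
  have hinner : {Z ∈ Λ'.powerset | Z ⊆ Λ} = Λ.powerset := by
    ext Z
    simpa using fun h : Z ⊆ Λ => h.trans hΛ
  have hsplit : S.generator Λ'.powerset Λ' r = S.generator Λ.powerset Λ r +
      S.generator {Z ∈ Λ'.powerset | ¬ Z ⊆ Λ} ∅ r + S.generator ∅ (Λ' \ Λ) r := by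
    simp only [generator, ← smul_add, Finset.sum_empty]
    rw [← Finset.sum_filter_add_sum_filter_not Λ'.powerset (· ⊆ Λ), hinner,
      ← Finset.sum_sdiff hΛ]
    congr 1
    abel
  have hb : S.dynamics Λ t r B ∈ closedLocalAlg Λ :=
    S.dynamics_mem (evenLocalAlg_le_closedLocalAlg Λ) t r hB
  have hpot : ⁅S.generator ∅ (Λ' \ Λ) r, S.dynamics Λ t r B⁆ = 0 :=
    (commute_of_disjoint Finset.sdiff_disjoint
      (S.generator_mem_evenLocalAlg (by simp) subset_rfl r) hb).lie_eq
  rw [← adCLM_apply] at hpot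
  rw [← adCLM_apply, ← adCLM_apply, hsplit, map_add, map_add, add_apply, add_apply, hpot]
  abel

theorem norm_lie_generator_dynamics_le (hα : ∀ t, (S.interaction t).normW F ≤ α)
    {𝒵 : Finset (Finset (Lattice d))} (h𝒵 : ∀ Z ∈ 𝒵, Z ⊆ Λ' ∧ ¬ Disjoint Z Y)
    (hB : B ∈ closedLocalAlg X) (t r : ℝ) :
    ‖⁅S.generator 𝒵 ∅ r, S.dynamics Λ t r B⁆‖ ≤
      2 * α * ‖B‖ * Real.exp (2 * F.D * α * |t - r|) * ∑ x ∈ X, ∑ y ∈ Y, F.kernel x y := by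
  set e := F.growth α |t - r|
  have he : 0 ≤ e := F.growth_nonneg α.coe_nonneg (abs_nonneg _)
  have hterm (Z : Finset (Lattice d)) :
      ‖⁅(S.interaction r).toFun Z, S.dynamics Λ t r B⁆‖ ≤
        2 * ‖B‖ * (‖(S.interaction r).toFun Z‖ * ∑ z ∈ Z, ∑ x ∈ X, F.lrKernel e z x) := by
    rw [Ring.lie_def, norm_sub_rev, ← Ring.lie_def]
    refine (norm_lie_dynamics_le_lrKernel hα ((S.interaction r).mem_evenLocalAlg subset_rfl) hB
      t r).trans_eq ?_
    rw [Finset.sum_comm]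
    simp only [F.lrKernel_comm]
    ring
  calc ‖⁅S.generator 𝒵 ∅ r, S.dynamics Λ t r B⁆‖
      ≤ ∑ Z ∈ 𝒵, ‖⁅(S.interaction r).toFun Z, S.dynamics Λ t r B⁆‖ :=
        S.norm_lie_map_generator_le 𝒵 (.id ℂ _) _ r
    _ ≤ 2 * ‖B‖ * ∑ Z ∈ 𝒵, ‖(S.interaction r).toFun Z‖ * ∑ z ∈ Z, ∑ x ∈ X, F.lrKernel e z x := by
        rw [Finset.mul_sum]
        exact Finset.sum_le_sum fun Z _ => hterm Z
    _ ≤ 2 * ‖B‖ * (α * ∑ y ∈ Y, ∑ z ∈ Λ', F.kernel y z * ∑ x ∈ X, F.lrKernel e z x) := by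
        gcongr
        exact Interaction.sum_norm_mul_sum_le (hα r) (fun Z hZ => (h𝒵 Z hZ).1)
          (fun Z hZ => (h𝒵 Z hZ).2)
          fun z => Finset.sum_nonneg fun x _ => DecayFunction.lrKernel_nonneg he z x
    _ = 2 * ‖B‖ * (α * ∑ x ∈ X, ∑ y ∈ Y, ∑ z ∈ Λ', F.kernel y z * F.lrKernel e z x) := by
        rw [Finset.sum_comm (s := X)]
        simp only [Finset.mul_sum, Finset.sum_comm (s := X)]
    _ ≤ 2 * ‖B‖ * (α * ∑ x ∈ X, ∑ y ∈ Y, Real.exp (2 * F.D * α * |t - r|) * F.kernel x y) := by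
        gcongr with x _ y _
        rw [← F.one_add_D_mul_growth, F.kernel_comm x y]
        exact F.sum_kernel_mul_lrKernel_le he y x Λ'
    _ = _ := by
        simp only [← Finset.mul_sum]
        ring

theorem norm_dynamics_sub_dynamics_le (hα : ∀ t, (S.interaction t).normW F ≤ α) (hΛ : Λ ⊆ Λ')
    (hX : X ⊆ Λ) (hB : B ∈ closedLocalAlg X) (t s : ℝ) :
    ‖S.dynamics Λ' t s B - S.dynamics Λ t s B‖ ≤
      2 * α * ‖B‖ * Real.exp (2 * F.D * α * |t - s|) *
        (∑ x ∈ X, ∑ y ∈ Λ' \ Λ, F.kernel x y) * |t - s| := by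
  classical
  have := F.D_pos
  have hkernel : 0 ≤ ∑ x ∈ X, ∑ y ∈ Λ' \ Λ, F.kernel x y :=
    Finset.sum_nonneg fun x _ => Finset.sum_nonneg fun y _ => (F.kernel_pos x y).le
  have hmeet : ∀ Z ∈ ({Z ∈ Λ'.powerset | ¬ Z ⊆ Λ} : Finset _), Z ⊆ Λ' ∧ ¬ Disjoint Z (Λ' \ Λ) := by
    intro Z hZ
    obtain ⟨hZΛ', hZΛ⟩ := Finset.mem_filter.1 hZ
    rw [Finset.mem_powerset] at hZΛ'
    exact ⟨hZΛ', fun h => hZΛ fun z hz => by_contra fun hzΛ =>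
      Finset.disjoint_left.1 h hz (Finset.mem_sdiff.2 ⟨hZΛ' hz, hzΛ⟩)⟩
  have key := norm_sub_le_of_norm_deriv_le s t
    (C := 2 * α * ‖B‖ * Real.exp (2 * F.D * α * |t - s|) * ∑ x ∈ X, ∑ y ∈ Λ' \ Λ, F.kernel x y)
    (S.hasDerivAt_dynamics_dynamics hΛ (closedLocalAlg_mono hX hB) t s) fun r _ hr => ?_
  · simpa only [flow_self] using key
  · rw [S.norm_flow]
    refine (norm_lie_generator_dynamics_le hα hmeet hB t r).trans ?_
    gcongr

end FermiSystem

end LiebRobinson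

/-! ### The infinite-volume dynamics -/

section Boxes

variable {d : ℕ}

theorem box_mono {L L' : ℝ} (h : L ≤ L') : (box L : Finset (Lattice d)) ⊆ box L' := fun x hx => by
  rw [mem_box] at hx ⊢
  exact fun i => (hx i).trans h

theorem exists_mem_box (x : Lattice d) : ∃ n : ℕ, x ∈ box (n : ℝ) := by
  obtain ⟨n, hn⟩ := exists_nat_ge (∑ i, |(x i : ℝ)|)
  exact ⟨n, (mem_box _ _).2 fun i => (Finset.single_le_sum (f := fun i => |(x i : ℝ)|)
    (fun i _ => abs_nonneg _) (Finset.mem_univ i)).trans hn⟩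

theorem tendsto_box : Filter.Tendsto (fun L : ℝ≥0 => (box (L : ℝ) : Finset (Lattice d)))
    Filter.atTop Filter.atTop :=
  Filter.tendsto_atTop_finset_of_monotone (fun _ _ h => box_mono (NNReal.coe_le_coe.2 h))
    fun x => (exists_mem_box x).imp' (fun n : ℕ => (n : ℝ≥0)) fun n hn => by simpa using hn

end Boxes

namespace FermiSystem

variable {d : ℕ} {S : FermiSystem d} {F : DecayFunction d} {α : ℝ≥0}

theorem cauchySeq_dynamics_of_mem_localAlg (hα : ∀ t, (S.interaction t).normW F ≤ α) (t s : ℝ)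
    {X : Finset (Lattice d)} {B : CAR d} (hB : B ∈ localAlg X) :
    CauchySeq fun Λ => S.dynamics Λ t s B := by
  set C := 2 * α * ‖B‖ * Real.exp (2 * F.D * α * |t - s|) * |t - s|
  have hC : 0 < C + 1 := add_pos_of_nonneg_of_pos (by positivity) one_pos
  have hsummable : Summable fun y => ∑ x ∈ X, F.kernel x y :=
    summable_sum fun x _ => F.summable_kernel x
  refine Metric.cauchySeq_iff'.2 fun ε hε => ?_
  obtain ⟨Λ₀, hΛ₀⟩ := summable_iff_vanishing_norm.1 hsummable (ε / (C + 1)) (div_pos hε hC)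
  refine ⟨Λ₀ ∪ X, fun Λ hΛ => ?_⟩
  set tail := ∑ y ∈ Λ \ (Λ₀ ∪ X), ∑ x ∈ X, F.kernel x y
  have htail : 0 ≤ tail :=
    Finset.sum_nonneg fun y _ => Finset.sum_nonneg fun x _ => (F.kernel_pos x y).le
  have htail_lt : tail < ε / (C + 1) := (le_abs_self _).trans_lt (hΛ₀ _
    (Finset.sdiff_disjoint.mono_right Finset.subset_union_left))
  calc dist (S.dynamics Λ t s B) (S.dynamics (Λ₀ ∪ X) t s B)
      ≤ 2 * α * ‖B‖ * Real.exp (2 * F.D * α * |t - s|) *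
          (∑ x ∈ X, ∑ y ∈ Λ \ (Λ₀ ∪ X), F.kernel x y) * |t - s| := by
        rw [dist_eq_norm]
        exact norm_dynamics_sub_dynamics_le hα hΛ Finset.subset_union_right
          (localAlg_le_closedLocalAlg X hB) t s
    _ = C * tail := by rw [Finset.sum_comm, mul_right_comm]
    _ ≤ (C + 1) * tail := by gcongr; simp
    _ < ε := (lt_div_iff₀' hC).1 htail_lt

theorem cauchySeq_dynamics (hα : ∀ t, (S.interaction t).normW F ≤ α) (t s : ℝ) (B : CAR d) :
    CauchySeq fun Λ => S.dynamics Λ t s B := by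
  refine Metric.cauchySeq_iff'.2 fun ε hε => ?_
  obtain ⟨b, hb, hBb⟩ := dense_iUnion_localAlg.exists_dist_lt B (by positivity : 0 < ε / 3)
  obtain ⟨X, hbX⟩ := Set.mem_iUnion.1 hb
  obtain ⟨Λ₀, hΛ₀⟩ := Metric.cauchySeq_iff'.1 (cauchySeq_dynamics_of_mem_localAlg hα t s hbX)
    (ε / 3) (by positivity)
  have hclose (Λ) : dist (S.dynamics Λ t s B) (S.dynamics Λ t s b) < ε / 3 := by
    rw [dist_eq_norm, ← map_sub, S.norm_flow, ← dist_eq_norm]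
    exact hBb
  refine ⟨Λ₀, fun Λ hΛ => ?_⟩
  calc dist (S.dynamics Λ t s B) (S.dynamics Λ₀ t s B)
      ≤ dist (S.dynamics Λ t s B) (S.dynamics Λ t s b) +
          dist (S.dynamics Λ t s b) (S.dynamics Λ₀ t s b) +
          dist (S.dynamics Λ₀ t s b) (S.dynamics Λ₀ t s B) := dist_triangle4 ..
    _ < ε / 3 + ε / 3 + ε / 3 := by
        rw [dist_comm (S.dynamics Λ₀ t s b)]
        exact add_lt_add (add_lt_add (hclose Λ) (hΛ₀ Λ hΛ)) (hclose Λ₀)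
    _ = ε := add_thirds ε

theorem exists_isInfiniteVolumeDynamics (hα : ∀ t, (S.interaction t).normW F ≤ α) :
    ∃ τ, IsInfiniteVolumeDynamics S.interaction S.potential τ := by
  choose f hf using fun t s B => cauchySeq_tendsto_of_complete (cauchySeq_dynamics hα t s B)
  have hlim (t s) : Filter.Tendsto (fun (L : ℝ≥0) B => S.dynamics (box (L : ℝ)) t s B)
      Filter.atTop (nhds (f t s)) := tendsto_pi_nhds.2 fun B => (hf t s B).comp tendsto_box
  exact ⟨fun t s => continuousLinearMapOfTendsto _ (hlim t s), fun L => S.dynamics (box (L : ℝ)),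
    fun L => S.isFiniteVolumeDynamics_iff_eq_dynamics.2 rfl,
    fun t s B => tendsto_pi_nhds.1 (hlim t s) B⟩

theorem tendsto_dynamics (hα : ∀ t, (S.interaction t).normW F ≤ α)
    {τ : ℝ → ℝ → CAR d →L[ℂ] CAR d}
    (hτ : IsInfiniteVolumeDynamics S.interaction S.potential τ) (t s : ℝ) (B : CAR d) :
    Filter.Tendsto (fun Λ => S.dynamics Λ t s B) Filter.atTop (nhds (τ t s B)) := by
  obtain ⟨τL, hτL, hlim⟩ := hτ
  obtain ⟨b, hb⟩ := cauchySeq_tendsto_of_complete (cauchySeq_dynamics hα t s B)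
  obtain rfl : τL = fun L : ℝ≥0 => S.dynamics (box (L : ℝ)) :=
    funext fun L => S.isFiniteVolumeDynamics_iff_eq_dynamics.1 (hτL L)
  rwa [tendsto_nhds_unique (hlim t s B) (hb.comp tendsto_box)]

end FermiSystem

/-! ### Trees and multi-commutators -/

section Trees

variable {k : ℕ} {T : Finset (Sym2 ℕ)}

theorem le_of_mem_of_mem_trees (hT : T ∈ trees k) {e : Sym2 ℕ} (he : e ∈ T) {v : ℕ} (hv : v ∈ e) :
    v ≤ k := by
  induction k generalizing T with
  | zero =>
    rw [trees, Finset.mem_singleton] at hT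
    simp [hT] at he
  | succ k ih =>
    rw [trees, Finset.mem_image] at hT
    obtain ⟨⟨i, T'⟩, hiT', rfl⟩ := hT
    obtain ⟨hi, hT'⟩ := Finset.mem_product.1 hiT'
    rcases Finset.mem_insert.1 he with rfl | he
    · rcases Sym2.mem_iff.1 hv with rfl | rfl
      exacts [(Finset.mem_range.1 hi).le, le_rfl]
    · exact (ih hT' he).trans k.le_succ

theorem parent_insert_self (hT : T ∈ trees k) {i : ℕ} (hi : i ≤ k) :
    parent (insert s(i, k + 1) T) (k + 1) = i := by
  have hsingle : {v | v < k + 1 ∧ s(v, k + 1) ∈ insert s(i, k + 1) T} = {i} := by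
    ext v
    refine ⟨fun ⟨_, hv⟩ => ?_, fun hv => ?_⟩
    · rcases Finset.mem_insert.1 hv with h | h
      · exact Sym2.congr_left.1 h
      · exact absurd (le_of_mem_of_mem_trees hT h (Sym2.mem_mk_right v (k + 1))) (by omega)
    · obtain rfl : v = i := hv
      exact ⟨Nat.lt_succ_of_le hi, Finset.mem_insert_self _ _⟩
  rw [parent, hsingle, csInf_singleton]

theorem parent_insert_of_le {i j : ℕ} (hj : j ≤ k) :
    parent (insert s(i, k + 1) T) j = parent T j := by
  refine congrArg sInf (Set.ext fun v => and_congr_right fun hv => ?_)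
  refine Finset.mem_insert.trans (or_iff_right fun h => ?_)
  rw [Sym2.eq_iff] at h
  omega

theorem exists_mem_trees_parent_eq {p : ℕ → ℕ} (hp : ∀ j, 1 ≤ j → j ≤ k → p j < j) :
    ∃ T ∈ trees k, ∀ j, 1 ≤ j → j ≤ k → parent T j = p j := by
  induction k with
  | zero => exact ⟨∅, by simp [trees], fun j hj hjk => by omega⟩
  | succ k ih =>
    obtain ⟨T, hT, hpar⟩ := ih fun j hj hjk => hp j hj (by omega)
    have hlast : p (k + 1) < k + 1 := hp (k + 1) (by omega) le_rfl
    refine ⟨insert s(p (k + 1), k + 1) T, Finset.mem_image.2 ⟨(p (k + 1), T),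
      Finset.mem_product.2 ⟨Finset.mem_range.2 hlast, hT⟩, rfl⟩, fun j hj hjk => ?_⟩
    rcases Nat.le_or_eq_of_le_succ hjk with hjk | rfl
    · rw [parent_insert_of_le hjk, hpar j hj hjk]
    · exact parent_insert_self hT (Nat.le_of_lt_succ hlast)

end Trees

section MultiComm

variable {A : Type*} {k : ℕ}

section Ring

variable [Ring A] {b c : ℕ → A}

theorem multiComm_congr (h : ∀ j ≤ k, b j = c j) : multiComm b k = multiComm c k := by
  induction k with
  | zero => exact h 0 le_rfl
  | succ k ih => rw [multiComm, multiComm, ih fun j hj => h j (by omega), h (k + 1) le_rfl]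

theorem commute_multiComm {a : A} (h : ∀ i ≤ k, Commute a (b i)) : Commute a (multiComm b k) := by
  induction k with
  | zero => exact h 0 le_rfl
  | succ k ih =>
    have hlast := h (k + 1) le_rfl
    have hk := ih fun i hi => h i (by omega)
    exact (hlast.mul_right hk).sub_right (hk.mul_right hlast)

theorem exists_lt_not_commute_of_multiComm_ne_zero (hne : multiComm b k ≠ 0) {j : ℕ} (hj : 1 ≤ j)
    (hjk : j ≤ k) : ∃ i < j, ¬ Commute (b j) (b i) := by
  induction k with
  | zero => omega
  | succ k ih =>
    rcases Nat.le_or_eq_of_le_succ hjk with hjk | rfl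
    · exact ih (fun h0 => hne (by simp [multiComm, h0])) hjk
    · by_contra! hcomm
      exact hne (sub_eq_zero.2 (commute_multiComm fun i hi => hcomm i (Nat.lt_succ_of_le hi)))

end Ring

variable [NormedRing A]

theorem norm_multiComm_le (b : ℕ → A) (k : ℕ) :
    ‖multiComm b k‖ ≤ 2 ^ k * ∏ j ∈ Finset.range (k + 1), ‖b j‖ := by
  induction k with
  | zero => simp [multiComm]
  | succ k ih =>
    calc ‖⁅b (k + 1), multiComm b k⁆‖
        ≤ 2 * ‖b (k + 1)‖ * ‖multiComm b k‖ := norm_lie_le _ _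
      _ ≤ 2 * ‖b (k + 1)‖ * (2 ^ k * ∏ j ∈ Finset.range (k + 1), ‖b j‖) := by gcongr
      _ = 2 ^ (k + 1) * ∏ j ∈ Finset.range (k + 1 + 1), ‖b j‖ := by
          rw [Finset.prod_range_succ _ (k + 1)]
          ring

theorem tendsto_multiComm {ι : Type*} {l : Filter ι} {f : ι → ℕ → A} {b : ℕ → A}
    (h : ∀ j ≤ k, Filter.Tendsto (fun i => f i j) l (nhds (b j))) :
    Filter.Tendsto (fun i => multiComm (f i) k) l (nhds (multiComm b k)) := by
  induction k with
  | zero => exact h 0 le_rfl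
  | succ k ih =>
    have hk := ih fun j hj => h j (by omega)
    have hlast := h (k + 1) le_rfl
    exact (hlast.mul hk).sub (hk.mul hlast)

end MultiComm

section TreeBound

variable {d k : ℕ} {n : ℕ → ℕ} {x : ℕ → Lattice d}

theorem kappa_nonneg (k : ℕ) (T : Finset (Sym2 ℕ)) (n : ℕ → ℕ) (x : ℕ → Lattice d) :
    0 ≤ kappa k T n x :=
  Finset.prod_nonneg fun _ _ => ite_nonneg zero_le_one le_rfl

theorem kappa_le_one (k : ℕ) (T : Finset (Sym2 ℕ)) (n : ℕ → ℕ) (x : ℕ → Lattice d) :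
    kappa k T n x ≤ 1 :=
  Finset.prod_le_one (fun _ _ => ite_nonneg zero_le_one le_rfl) fun _ _ => by
    split_ifs <;> norm_num

theorem one_le_sum_kappa
    (h : ∀ j, 1 ≤ j → j ≤ k → ∃ i < j, (boxAt (n j) (x j) ∩ boxAt (n i) (x i)).Nonempty) :
    1 ≤ ∑ T ∈ trees k, kappa k T n x := by
  choose! p hp hmeet using h
  obtain ⟨T, hT, hpar⟩ := exists_mem_trees_parent_eq hp
  have hone : kappa k T n x = 1 := Finset.prod_eq_one fun j hj => by
    obtain ⟨hj, hjk⟩ := Finset.mem_Icc.1 hj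
    rw [hpar j hj hjk, if_pos (hmeet j hj hjk)]
  exact hone.ge.trans (Finset.single_le_sum (fun T _ => kappa_nonneg k T n x) hT)

/-- A non-vanishing multi-commutator defines a tree: each vertex `j` is joined to some `i < j` for
which `b_j` and `b_i` do not commute. -/
theorem norm_multiComm_le_sum_kappa {b : ℕ → CAR d}
    (h0 : b 0 ∈ closedLocalAlg (boxAt (n 0) (x 0)))
    (h : ∀ j, 1 ≤ j → j ≤ k → b j ∈ evenLocalAlg (boxAt (n j) (x j))) :
    ‖multiComm b k‖ ≤
      2 ^ k * (∏ j ∈ Finset.range (k + 1), ‖b j‖) * ∑ T ∈ trees k, kappa k T n x := by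
  by_cases hne : multiComm b k = 0
  · have := Finset.sum_nonneg fun T (_ : T ∈ trees k) => kappa_nonneg k T n x
    rw [hne, norm_zero]
    positivity
  refine (norm_multiComm_le b k).trans (le_mul_of_one_le_right (by positivity)
    (one_le_sum_kappa fun j hj hjk => ?_))
  obtain ⟨i, hij, hcomm⟩ := exists_lt_not_commute_of_multiComm_ne_zero hne hj hjk
  have hi : b i ∈ closedLocalAlg (boxAt (n i) (x i)) := by
    rcases Nat.eq_zero_or_pos i with rfl | hi
    exacts [h0, evenLocalAlg_le_closedLocalAlg _ (h i hi (by omega))]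
  exact ⟨i, hij, Finset.nonempty_iff_ne_empty.2 fun hdisj => hcomm (commute_of_disjoint
    (Finset.disjoint_iff_inter_eq_empty.2 hdisj) (h j hj hjk) hi)⟩

end TreeBound

section Expansion

variable {m : ℕ → ℕ} {I : ℕ → Finset ℕ} {k : ℕ}

variable (m I) in
open Classical in
/-- The sequences `ν` with `ν_j ∈ I_j` for `1 ≤ j ≤ k` and `ν_j = m_j` for all other `j`; they
label the terms in the expansion of a multi-commutator of sums. -/
noncomputable def multiIndices : ℕ → Finset (ℕ → ℕ)
  | 0 => {m}
  | k + 1 => (multiIndices k ×ˢ I (k + 1)).image fun p => Function.update p.1 (k + 1) p.2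

theorem mem_of_mem_multiIndices {ν : ℕ → ℕ} (h : ν ∈ multiIndices m I k) {j : ℕ} (hj : 1 ≤ j)
    (hjk : j ≤ k) : ν j ∈ I j := by
  classical
  induction k generalizing ν with
  | zero => omega
  | succ k ih =>
    obtain ⟨⟨μ, n⟩, hμn, rfl⟩ := Finset.mem_image.1 h
    obtain ⟨hμ, hn⟩ := Finset.mem_product.1 hμn
    rcases Nat.le_or_eq_of_le_succ hjk with hjk | rfl
    · rw [Function.update_of_ne (by omega)]
      exact ih hμ hjk
    · rwa [Function.update_self]

theorem eq_of_mem_multiIndices {ν : ℕ → ℕ} (h : ν ∈ multiIndices m I k) {j : ℕ}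
    (hj : j ∉ Finset.Icc 1 k) : ν j = m j := by
  classical
  induction k generalizing ν with
  | zero => rw [Finset.mem_singleton.1 h]
  | succ k ih =>
    obtain ⟨⟨μ, n⟩, hμn, rfl⟩ := Finset.mem_image.1 h
    simp only [Finset.mem_Icc] at hj ih
    rw [Function.update_of_ne (by omega)]
    exact ih (Finset.mem_product.1 hμn).1 (by omega)

theorem sum_multiIndices_succ {M : Type*} [AddCommMonoid M] (f : (ℕ → ℕ) → M) :
    ∑ ν ∈ multiIndices m I (k + 1), f ν =
      ∑ ν ∈ multiIndices m I k, ∑ n ∈ I (k + 1), f (Function.update ν (k + 1) n) := by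
  classical
  rw [multiIndices, Finset.sum_image, Finset.sum_product]
  rintro ⟨ν, n⟩ hν ⟨ν', n'⟩ hν' (heq : Function.update ν (k + 1) n = Function.update ν' (k + 1) n')
  have hlast {μ : ℕ → ℕ} {l : ℕ} (hμ : (μ, l) ∈ multiIndices m I k ×ˢ I (k + 1)) :
      μ (k + 1) = m (k + 1) :=
    eq_of_mem_multiIndices (Finset.mem_product.1 hμ).1 (by simp)
  refine Prod.ext (funext fun j => ?_) (by simpa using congrFun heq (k + 1))
  rcases eq_or_ne j (k + 1) with rfl | hne
  · exact (hlast hν).trans (hlast hν').symm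
  · simpa [hne] using congrFun heq j

theorem multiComm_eq_sum_multiIndices {A : Type*} [Ring A] {b : ℕ → A} {β : ℕ → ℕ → A}
    (h0 : b 0 = β 0 (m 0)) (h : ∀ j, 1 ≤ j → j ≤ k → b j = ∑ n ∈ I j, β j n) :
    multiComm b k = ∑ ν ∈ multiIndices m I k, multiComm (fun j => β j (ν j)) k := by
  induction k with
  | zero => simpa [multiComm, multiIndices] using h0
  | succ k ih =>
    have hupdate (ν : ℕ → ℕ) (n : ℕ) :
        multiComm (fun j => β j (Function.update ν (k + 1) n j)) (k + 1) =
          β (k + 1) n * multiComm (fun j => β j (ν j)) k -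
            multiComm (fun j => β j (ν j)) k * β (k + 1) n := by
      rw [multiComm, Function.update_self, multiComm_congr fun j hj => by
        rw [Function.update_of_ne (Nat.lt_succ_of_le hj).ne]]
    rw [multiComm, ih fun j hj hjk => h j hj (by omega), h (k + 1) (by omega) le_rfl,
      sum_multiIndices_succ, Finset.sum_mul_sum, Finset.sum_mul_sum, Finset.sum_comm,
      ← Finset.sum_sub_distrib]
    simp only [hupdate, Finset.sum_sub_distrib]

end Expansion

/-! ### The remainder -/

section IncreasingMaps

variable {l k : ℕ}

theorem card_imageSet {π : Finset.Icc l k → Finset.Icc 1 k} (hπ : StrictMono π) :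
    (imageSet π).card = k + 1 - l := by
  rw [imageSet, Finset.card_image_of_injective _ fun i i' h => hπ.injective (Subtype.ext h),
    Finset.card_univ, Fintype.card_coe, Nat.card_Icc]

theorem exists_imageSet_eq {J : Finset ℕ} (hJ : J ⊆ Finset.Icc 1 k) (hcard : J.card = k + 1 - l) :
    ∃ π ∈ increasingMaps l k, imageSet π = J := by
  let e : Finset.Icc l k ≃o J :=
    ((Finset.Icc l k).orderIsoOfFin (Nat.card_Icc l k)).symm.trans (J.orderIsoOfFin hcard)
  refine ⟨fun i => ⟨e i, hJ (e i).2⟩,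
    Finset.mem_filter.2 ⟨Finset.mem_univ _, fun i i' h => e.strictMono h⟩, ?_⟩
  ext j
  refine Finset.mem_image.trans ⟨?_, fun hj => ⟨e.symm ⟨j, hj⟩, Finset.mem_univ _, by simp⟩⟩
  rintro ⟨i, -, rfl⟩
  exact (e i).2

variable (k) in
theorem sum_powerset_le_sum_increasingMaps {g : Finset ℕ → ℝ} (hg : ∀ J, 0 ≤ g J) :
    ∑ J ∈ (Finset.Icc 1 k).powerset, g J ≤
      g ∅ + ∑ l ∈ Finset.Icc 1 k, ∑ π ∈ increasingMaps l k, g (imageSet π) := by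
  have hmaps : ∀ J ∈ (Finset.Icc 1 k).powerset.erase ∅, k + 1 - J.card ∈ Finset.Icc 1 k := by
    intro J hJ
    obtain ⟨hne, hJ⟩ := Finset.mem_erase.1 hJ
    have hpos : 0 < J.card := Finset.card_pos.2 (Finset.nonempty_iff_ne_empty.2 hne)
    have hle : J.card ≤ k := (Finset.card_le_card (Finset.mem_powerset.1 hJ)).trans_eq (by simp)
    exact Finset.mem_Icc.2 (by omega)
  rw [← Finset.add_sum_erase _ _ (Finset.empty_mem_powerset _),
    ← Finset.sum_fiberwise_of_maps_to hmaps]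
  gcongr with l hl
  have hsub : {J ∈ (Finset.Icc 1 k).powerset.erase ∅ | k + 1 - J.card = l} ⊆
      (increasingMaps l k).image imageSet := by
    intro J hJ
    obtain ⟨hJ, hcard⟩ := Finset.mem_filter.1 hJ
    have hlk := Finset.mem_Icc.1 hl
    exact Finset.mem_image.2 (exists_imageSet_eq
      (Finset.mem_powerset.1 (Finset.mem_of_mem_erase hJ)) (by omega))
  exact (Finset.sum_le_sum_of_subset_of_nonneg hsub fun J _ _ => hg J).trans
    (Finset.sum_image_le_of_nonneg fun J _ => hg J)

end IncreasingMaps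

theorem summable_prod_pi {ι : Type*} [Fintype ι] {κ : ι → Type*} {g : ∀ i, κ i → ℝ}
    (hg : ∀ i a, 0 ≤ g i a) (hsummable : ∀ i, Summable (g i)) :
    Summable fun a : ∀ i, κ i => ∏ i, g i (a i) := by
  classical
  have hprod (a : ∀ i, κ i) : 0 ≤ ∏ i, g i (a i) := Finset.prod_nonneg fun i _ => hg i (a i)
  refine summable_of_sum_le (c := ∏ i, ∑' a, g i a) hprod fun u => ?_
  calc ∑ a ∈ u, ∏ i, g i (a i)
      ≤ ∑ a ∈ Fintype.piFinset fun i => u.image fun a => a i, ∏ i, g i (a i) :=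
        Finset.sum_le_sum_of_subset_of_nonneg
          (fun a ha => Fintype.mem_piFinset.2 fun i => Finset.mem_image_of_mem _ ha)
          fun a _ _ => hprod a
    _ = ∏ i, ∑ a ∈ u.image fun a => a i, g i a := (Finset.prod_univ_sum _ _).symm
    _ ≤ ∏ i, ∑' a, g i a := by
        refine Finset.prod_le_prod (fun i _ => Finset.sum_nonneg fun a _ => hg i a) fun i _ => ?_
        exact (hsummable i).sum_le_tsum _ fun a _ => hg i a

section Shells

variable {d : ℕ}

theorem pairwise_disjoint_shell :
    Pairwise (Function.onFun Disjoint
      fun n : ℕ => (box (n : ℝ) : Finset (Lattice d)) \ box ((n : ℝ) - 1)) := by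
  refine (pairwise_disjoint_on _).2 fun n n' h => ?_
  have hle : (n : ℝ) ≤ (n' : ℝ) - 1 := le_sub_iff_add_le.2 (by exact_mod_cast h)
  exact Finset.disjoint_of_subset_left (Finset.sdiff_subset.trans (box_mono hle))
    Finset.disjoint_sdiff

variable (F : DecayFunction d)

namespace DecayFunction

/-- The interaction strength `∑_{z ∈ Λ_m} ∑_{y ∈ Λ_n \ Λ_{n-1}} 𝐅(|z - y|)` between a box and a
shell. -/
noncomputable def shellSum (m n : ℕ) : ℝ :=
  ∑ z ∈ box m, ∑ y ∈ box n \ box ((n : ℝ) - 1), F.kernel z y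

theorem shellSum_nonneg (m n : ℕ) : 0 ≤ F.shellSum m n :=
  Finset.sum_nonneg fun z _ => Finset.sum_nonneg fun y _ => (F.kernel_pos z y).le

theorem summable_shellSum (m : ℕ) : Summable (F.shellSum m) := by
  refine summable_of_sum_le (c := (box (d := d) m).card • F.mass) (F.shellSum_nonneg m) fun A => ?_
  simp only [shellSum]
  rw [Finset.sum_comm]
  refine Finset.sum_le_card_nsmul _ _ _ fun z _ => ?_
  rw [← Finset.sum_biUnion (pairwise_disjoint_shell.set_pairwise _)]
  exact F.sum_kernel_le_mass z _

theorem sum_boxAt_shell (m : ℕ) {n : ℕ} (hn : 1 ≤ n) (x : Lattice d) :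
    ∑ z ∈ boxAt m x, ∑ y ∈ boxAt n x \ boxAt ((n - 1 : ℕ) : ℝ) x, F.kernel z y =
      F.shellSum m n := by
  have hinj : Function.Injective fun y : Lattice d => y + x := add_left_injective x
  rw [Nat.cast_sub hn, Nat.cast_one, boxAt, boxAt, boxAt, ← Finset.image_sdiff _ _ hinj,
    Finset.sum_image hinj.injOn, shellSum]
  simp only [Finset.sum_image hinj.injOn, kernel, add_sub_add_right_eq_sub]

theorem prod_shellSum {ι : Type*} [Fintype ι] [DecidableEq ι] (m n : ι → ℕ) :
    ∏ i, F.shellSum (m i) (n i) =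
      ∑ z ∈ Fintype.piFinset fun i => box (d := d) (m i),
        ∑ y ∈ Fintype.piFinset fun i => box (d := d) (n i) \ box ((n i : ℝ) - 1),
          ∏ i, F.kernel (z i) (y i) := by
  simp only [shellSum, Finset.prod_univ_sum]

/-- The weight of the `n`-th term in the expansion of an evolved observable on the box `Λ_m` with
respect to the growing boxes `Λ_m, Λ_{m+1}, …`; the factor `c` carries the dependence on time. -/
noncomputable def shellWeight (c : ℝ) (m n : ℕ) : ℝ :=
  if n = m then 1 else c * F.shellSum m n

end DecayFunction

/-- The index families `(n_j)_{j ∈ J}` with `n_j ≥ m_j + 1` over which `ℜ_{T,α}` sums. -/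
abbrev RaisedIndices (J : Finset ℕ) (m : ℕ → ℕ) : Type :=
  {n : J → ℕ // ∀ j : J, m j + 1 ≤ n j}

variable (k : ℕ) (T : Finset (Sym2 ℕ)) (m : ℕ → ℕ) (x : ℕ → Lattice d) {J : Finset ℕ}

theorem extendBy_injective :
    Function.Injective fun n : RaisedIndices J m => extendBy J n.1 m := fun n n' h =>
  Subtype.ext <| funext fun j => by simpa [extendBy] using congrFun h j

variable {m} in
theorem exists_extendBy_eq {ν : ℕ → ℕ} (hraised : ∀ j ∈ J, m j < ν j)
    (hfixed : ∀ j ∉ J, ν j = m j) : ∃ n : RaisedIndices J m, extendBy J n.1 m = ν := by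
  refine ⟨⟨fun j => ν j, fun j => hraised j j.2⟩, funext fun j => ?_⟩
  by_cases hj : j ∈ J
  · simp [extendBy, hj]
  · simp [extendBy, hj, hfixed j hj]

theorem prod_shellWeight_extendBy {K : Finset ℕ} (hJ : J ⊆ K) (c : ℕ → ℝ)
    (n : RaisedIndices J m) :
    ∏ j ∈ K, F.shellWeight (c j) (m j) (extendBy J n.1 m j) =
      (∏ j ∈ J, c j) * ∏ j : J, F.shellSum (m j) (n.1 j) := by
  have hraised (j : J) : F.shellWeight (c j) (m j) (extendBy J n.1 m j) =
      c j * F.shellSum (m j) (n.1 j) := by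
    have hne : n.1 j ≠ m j := (Nat.lt_of_succ_le (n.2 j)).ne'
    simp [extendBy, DecayFunction.shellWeight, hne]
  rw [← Finset.prod_subset hJ fun j _ hj => by simp [extendBy, hj, DecayFunction.shellWeight],
    ← Finset.prod_coe_sort J, ← Finset.prod_coe_sort J, ← Finset.prod_mul_distrib]
  exact Finset.prod_congr rfl fun j _ => hraised j

theorem summable_kappa_mul_prod_shellSum (J : Finset ℕ) :
    Summable fun n : RaisedIndices J m =>
      kappa k T (extendBy J n.1 m) x * ∏ j : J, F.shellSum (m j) (n.1 j) := by
  have hprod (n : RaisedIndices J m) : 0 ≤ ∏ j : J, F.shellSum (m j) (n.1 j) :=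
    Finset.prod_nonneg fun j _ => F.shellSum_nonneg _ _
  have hsummable := summable_prod_pi (fun (j : J) n => F.shellSum_nonneg (m j) n)
    fun j => F.summable_shellSum (m j)
  exact Summable.of_nonneg_of_le (fun n => mul_nonneg (kappa_nonneg _ _ _ _) (hprod n))
    (fun n => mul_le_of_le_one_left (hprod n) (kappa_le_one _ _ _ _))
    (hsummable.comp_injective Subtype.val_injective)

/-- The contribution of the index set `J = J_π` to `ℜ_{T,α}`, with a general factor `c_j` in place
of `2 α |t_j| exp (4 𝐃 α |t_j|)`. -/
noncomputable def remainderTerm (c : ℕ → ℝ) (J : Finset ℕ) : ℝ :=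
  (∏ j ∈ J, c j) * ∑' n : RaisedIndices J m,
    kappa k T (extendBy J n.1 m) x * ∏ j : J, F.shellSum (m j) (n.1 j)

variable {c : ℕ → ℝ}

theorem remainderTerm_nonneg (hc : ∀ j, 0 ≤ c j) (J : Finset ℕ) :
    0 ≤ remainderTerm F k T m x c J :=
  mul_nonneg (Finset.prod_nonneg fun j _ => hc j) (tsum_nonneg fun _ =>
    mul_nonneg (kappa_nonneg _ _ _ _) (Finset.prod_nonneg fun _ _ => F.shellSum_nonneg _ _))

variable (c) in
theorem remainderTerm_empty : remainderTerm F k T m x c ∅ = kappa k T m x := by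
  have : Unique (RaisedIndices ∅ m) :=
    { default := ⟨fun _ => 0, fun j => absurd j.2 (Finset.notMem_empty _)⟩
      uniq := fun _ => Subtype.ext (Subsingleton.elim _ _) }
  have hext (n : RaisedIndices ∅ m) : extendBy ∅ n.1 m = m := funext fun j => by simp [extendBy]
  simp [remainderTerm, tsum_fintype, hext]

theorem sum_le_remainderTerm (hc : ∀ j, 0 ≤ c j) (hJ : J ⊆ Finset.Icc 1 k)
    {𝒩 : Finset (ℕ → ℕ)} (h𝒩 : ∀ ν ∈ 𝒩, (∀ j ∈ J, m j < ν j) ∧ ∀ j ∉ J, ν j = m j) :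
    ∑ ν ∈ 𝒩, kappa k T ν x * ∏ j ∈ Finset.Icc 1 k, F.shellWeight (c j) (m j) (ν j) ≤
      remainderTerm F k T m x c J := by
  have hsummable := summable_kappa_mul_prod_shellSum F k T m x J
  have hrange (ν) (hν : ν ∈ 𝒩) :
      ν ∈ Set.range fun n : RaisedIndices J m => extendBy J n.1 m :=
    exists_extendBy_eq (h𝒩 ν hν).1 (h𝒩 ν hν).2
  rw [← Finset.sum_preimage (fun n : RaisedIndices J m => extendBy J n.1 m) 𝒩
    (extendBy_injective m).injOn _ fun ν hν hν' => absurd (hrange ν hν) hν']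
  simp only [prod_shellWeight_extendBy F m hJ, mul_left_comm (kappa _ _ _ _)]
  rw [remainderTerm, ← Finset.mul_sum]
  gcongr
  · exact Finset.prod_nonneg fun j _ => hc j
  · exact hsummable.sum_le_tsum _ fun n _ => mul_nonneg (kappa_nonneg _ _ _ _)
      (Finset.prod_nonneg fun _ _ => F.shellSum_nonneg _ _)

theorem sum_multiIndices_le_sum_remainderTerm (hc : ∀ j, 0 ≤ c j) (N : ℕ) :
    ∑ ν ∈ multiIndices m (fun j => Finset.Icc (m j) N) k,
        kappa k T ν x * ∏ j ∈ Finset.Icc 1 k, F.shellWeight (c j) (m j) (ν j) ≤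
      ∑ J ∈ (Finset.Icc 1 k).powerset, remainderTerm F k T m x c J := by
  classical
  rw [← Finset.sum_fiberwise_of_maps_to (t := (Finset.Icc 1 k).powerset)
    (g := fun ν => {j ∈ Finset.Icc 1 k | ν j ≠ m j})
    fun ν _ => Finset.mem_powerset.2 (Finset.filter_subset _ _)]
  refine Finset.sum_le_sum fun J hJ =>
    sum_le_remainderTerm F k T m x hc (Finset.mem_powerset.1 hJ) fun ν hνJ => ?_
  obtain ⟨hν, rfl⟩ := Finset.mem_filter.1 hνJ
  simp only [Finset.mem_filter]
  refine ⟨fun j ⟨hj, hne⟩ => ?_, fun j hj => ?_⟩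
  · obtain ⟨hj, hjk⟩ := Finset.mem_Icc.1 hj
    exact (Finset.mem_Icc.1 (mem_of_mem_multiIndices hν hj hjk)).1.lt_of_ne' hne
  · by_cases hjk : j ∈ Finset.Icc 1 k
    · exact not_not.1 fun hne => hj ⟨hjk, hne⟩
    · exact eq_of_mem_multiIndices hν hjk

/-- The factor by which an index `j ∈ J_π` with time `t_j` enters `ℜ_{T,α}`. -/
noncomputable def DecayFunction.timeFactor (α t : ℝ) : ℝ :=
  2 * α * (|t| * Real.exp (4 * F.D * α * |t|))

theorem DecayFunction.timeFactor_nonneg {α : ℝ} (hα : 0 ≤ α) (t : ℝ) : 0 ≤ F.timeFactor α t := by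
  unfold timeFactor
  positivity

theorem remainder_eq_sum_remainderTerm (α : ℝ) (t : ℕ → ℝ) :
    remainder F k T α t m x = ∑ l ∈ Finset.Icc 1 k, ∑ π ∈ increasingMaps l k,
      remainderTerm F k T m x (fun j => F.timeFactor α (t j)) (imageSet π) := by
  refine Finset.sum_congr rfl fun l hl => ?_
  rw [Finset.mul_sum]
  refine Finset.sum_congr rfl fun π hπ => ?_
  have hcard : (imageSet π).card = k - l + 1 := by
    rw [card_imageSet (Finset.mem_filter.1 hπ).2, Nat.sub_add_comm (Finset.mem_Icc.1 hl).2]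
  have hprod : ∏ j ∈ imageSet π, F.timeFactor α (t j) =
      (2 * α) ^ (k - l + 1) * ∏ j ∈ imageSet π, |t j| * Real.exp (4 * F.D * α * |t j|) := by
    simp only [DecayFunction.timeFactor]
    rw [Finset.prod_mul_distrib, Finset.prod_const, hcard]
  rw [remainderTerm, hprod, ← mul_assoc]
  simp only [DecayFunction.prod_shellSum, Finset.mul_sum, DecayFunction.kernel]

theorem sum_multiIndices_le_kappa_add_remainder {α : ℝ} (hα : 0 ≤ α) (t : ℕ → ℝ) (N : ℕ) :
    ∑ ν ∈ multiIndices m (fun j => Finset.Icc (m j) N) k, kappa k T ν x *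
        ∏ j ∈ Finset.Icc 1 k, F.shellWeight (F.timeFactor α (t j)) (m j) (ν j) ≤
      kappa k T m x + remainder F k T α t m x := by
  have hc (j) := F.timeFactor_nonneg hα (t j)
  rw [remainder_eq_sum_remainderTerm, ← remainderTerm_empty F k T m x]
  exact (sum_multiIndices_le_sum_remainderTerm F k T m x hc N).trans
    (sum_powerset_le_sum_increasingMaps k (remainderTerm_nonneg F k T m x hc))

end Shells

/-! ### Lieb–Robinson bounds for multi-commutators -/

section TranslatedBoxes

variable {d : ℕ}

theorem boxAt_mono {L L' : ℝ} (h : L ≤ L') (x : Lattice d) : boxAt L x ⊆ boxAt L' x :=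
  Finset.image_subset_image (box_mono h)

theorem tendsto_boxAt (x : Lattice d) :
    Filter.Tendsto (fun n : ℕ => boxAt (n : ℝ) x) Filter.atTop Filter.atTop :=
  Filter.tendsto_atTop_finset_of_monotone (fun _ _ h => boxAt_mono (Nat.cast_le.2 h) x)
    fun y => (exists_mem_box (y - x)).imp fun _ hn =>
      Finset.mem_image.2 ⟨y - x, hn, sub_add_cancel y x⟩

end TranslatedBoxes

namespace FermiSystem

variable {d : ℕ} (S : FermiSystem d)

/-- The `n`-th term of the telescoping expansion of `τ_{t,s}(b)`, for `b` supported in `Λ_m + x`,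
in the dynamics of the boxes `Λ_n + x`, `n ≥ m`. -/
noncomputable def shellTerm (t s : ℝ) (x : Lattice d) (b : CAR d) (m n : ℕ) : CAR d :=
  if n = m then S.dynamics (boxAt n x) t s b
  else S.dynamics (boxAt n x) t s b - S.dynamics (boxAt ((n - 1 : ℕ) : ℝ) x) t s b

theorem sum_shellTerm (t s : ℝ) (x : Lattice d) (b : CAR d) {m N : ℕ} (h : m ≤ N) :
    ∑ n ∈ Finset.Icc m N, S.shellTerm t s x b m n = S.dynamics (boxAt N x) t s b := by
  induction N, h using Nat.le_induction with
  | base => simp [shellTerm]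
  | succ N h ih =>
    rw [Finset.sum_Icc_succ_top (by omega), ih, shellTerm, if_neg (by omega), Nat.add_sub_cancel,
      add_sub_cancel]

variable {S}

theorem shellTerm_mem_evenLocalAlg (t s : ℝ) {x : Lattice d} {b : CAR d} {m n : ℕ}
    (hb : b ∈ evenLocalAlg (boxAt m x)) (h : m ≤ n) :
    S.shellTerm t s x b m n ∈ evenLocalAlg (boxAt n x) := by
  have hmem {n' : ℕ} (hn' : n' ≤ n) : S.dynamics (boxAt n' x) t s b ∈ evenLocalAlg (boxAt n x) :=
    S.dynamics_mem (evenLocalAlg_mono (boxAt_mono (Nat.cast_le.2 hn') x)) t s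
      (evenLocalAlg_mono (boxAt_mono (Nat.cast_le.2 h) x) hb)
  unfold shellTerm
  split_ifs
  exacts [hmem le_rfl, sub_mem (hmem le_rfl) (hmem (Nat.sub_le n 1))]

variable {F : DecayFunction d} {α : ℝ≥0}

theorem norm_shellTerm_le (hα : ∀ t, (S.interaction t).normW F ≤ α) (t s : ℝ) {x : Lattice d}
    {b : CAR d} {m n : ℕ} (hb : b ∈ closedLocalAlg (boxAt m x)) (h : m ≤ n) :
    ‖S.shellTerm t s x b m n‖ ≤ ‖b‖ * F.shellWeight (F.timeFactor α (t - s)) m n := by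
  unfold shellTerm DecayFunction.shellWeight
  split_ifs with hn
  · rw [S.norm_flow, mul_one]
  have hD := F.D_pos
  have hshell := F.shellSum_nonneg m n
  calc ‖S.dynamics (boxAt n x) t s b - S.dynamics (boxAt ((n - 1 : ℕ) : ℝ) x) t s b‖
      ≤ 2 * α * ‖b‖ * Real.exp (2 * F.D * α * |t - s|) * F.shellSum m n * |t - s| := by
        rw [← F.sum_boxAt_shell m (by omega) x]
        exact norm_dynamics_sub_dynamics_le hα (boxAt_mono (Nat.cast_le.2 (Nat.sub_le n 1)) x)
          (boxAt_mono (Nat.cast_le.2 (by omega)) x) hb t s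
    _ ≤ 2 * α * ‖b‖ * Real.exp (4 * F.D * α * |t - s|) * F.shellSum m n * |t - s| := by
        gcongr
        norm_num
    _ = ‖b‖ * (F.timeFactor α (t - s) * F.shellSum m n) := by
        rw [DecayFunction.timeFactor]
        ring

section MultiComm

variable {k : ℕ} {m : ℕ → ℕ} {x : ℕ → Lattice d} {b : ℕ → CAR d}

theorem norm_multiComm_shellTerm_le (hα : ∀ t, (S.interaction t).normW F ≤ α)
    (h0 : b 0 ∈ closedLocalAlg (boxAt (m 0) (x 0)))
    (h : ∀ j, 1 ≤ j → j ≤ k → b j ∈ evenLocalAlg (boxAt (m j) (x j)))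
    {ν : ℕ → ℕ} (hν0 : ν 0 = m 0) (hν : ∀ j, 1 ≤ j → j ≤ k → m j ≤ ν j) (t : ℕ → ℝ) (s : ℝ) :
    ‖multiComm (fun j => if j = 0 then b 0
        else S.shellTerm (t j) s (x j) (b j) (m j) (ν j)) k‖ ≤
      2 ^ k * (∏ j ∈ Finset.range (k + 1), ‖b j‖) * ∑ T ∈ trees k, kappa k T ν x *
        ∏ j ∈ Finset.Icc 1 k, F.shellWeight (F.timeFactor α (t j - s)) (m j) (ν j) := by
  set β : ℕ → CAR d := fun j =>
    if j = 0 then b 0 else S.shellTerm (t j) s (x j) (b j) (m j) (ν j)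
  set weight : ℝ := ∏ j ∈ Finset.Icc 1 k, F.shellWeight (F.timeFactor α (t j - s)) (m j) (ν j)
  have hβj {j : ℕ} (hj : 1 ≤ j) : β j = S.shellTerm (t j) s (x j) (b j) (m j) (ν j) :=
    if_neg (by omega)
  have hsplit (f : ℕ → ℝ) :
      ∏ j ∈ Finset.range (k + 1), f j = f 0 * ∏ j ∈ Finset.Icc 1 k, f j :=
    Finset.prod_range_eq_mul_Ico f k.succ_pos
  have hprod : ∏ j ∈ Finset.range (k + 1), ‖β j‖ ≤
      (∏ j ∈ Finset.range (k + 1), ‖b j‖) * weight := by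
    rw [hsplit, hsplit, mul_assoc, ← Finset.prod_mul_distrib]
    refine mul_le_mul_of_nonneg_left (Finset.prod_le_prod (fun _ _ => norm_nonneg _)
      fun j hj => ?_) (norm_nonneg _)
    obtain ⟨hj, hjk⟩ := Finset.mem_Icc.1 hj
    rw [hβj hj]
    exact norm_shellTerm_le hα (t j) s (evenLocalAlg_le_closedLocalAlg _ (h j hj hjk))
      (hν j hj hjk)
  have hκ : 0 ≤ ∑ T ∈ trees k, kappa k T ν x := Finset.sum_nonneg fun T _ => kappa_nonneg k T ν x
  calc ‖multiComm β k‖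
      ≤ 2 ^ k * (∏ j ∈ Finset.range (k + 1), ‖β j‖) * ∑ T ∈ trees k, kappa k T ν x :=
        norm_multiComm_le_sum_kappa (by rwa [hν0]) fun j hj hjk => by
          rw [hβj hj]
          exact shellTerm_mem_evenLocalAlg _ _ (h j hj hjk) (hν j hj hjk)
    _ ≤ 2 ^ k * ((∏ j ∈ Finset.range (k + 1), ‖b j‖) * weight) *
          ∑ T ∈ trees k, kappa k T ν x := by gcongr
    _ = 2 ^ k * (∏ j ∈ Finset.range (k + 1), ‖b j‖) *
          ∑ T ∈ trees k, kappa k T ν x * weight := by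
        rw [← Finset.sum_mul]
        ring

theorem norm_multiComm_dynamics_boxAt_le (hα : ∀ t, (S.interaction t).normW F ≤ α)
    (h0 : b 0 ∈ closedLocalAlg (boxAt (m 0) (x 0)))
    (h : ∀ j, 1 ≤ j → j ≤ k → b j ∈ evenLocalAlg (boxAt (m j) (x j)))
    {N : ℕ} (hN : ∀ j, 1 ≤ j → j ≤ k → m j ≤ N) (t : ℕ → ℝ) (s : ℝ) :
    ‖multiComm (fun j => if j = 0 then b 0
        else S.dynamics (boxAt N (x j)) (t j) s (b j)) k‖ ≤
      2 ^ k * (∏ j ∈ Finset.range (k + 1), ‖b j‖) *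
        ∑ T ∈ trees k, (kappa k T m x + remainder F k T α (fun j => t j - s) m x) := by
  set 𝒩 := multiIndices m (fun j => Finset.Icc (m j) N) k
  set weight : (ℕ → ℕ) → ℝ := fun ν =>
    ∏ j ∈ Finset.Icc 1 k, F.shellWeight (F.timeFactor α (t j - s)) (m j) (ν j)
  have hexpand : multiComm (fun j => if j = 0 then b 0
        else S.dynamics (boxAt N (x j)) (t j) s (b j)) k =
      ∑ ν ∈ 𝒩, multiComm (fun j => if j = 0 then b 0
        else S.shellTerm (t j) s (x j) (b j) (m j) (ν j)) k :=
    multiComm_eq_sum_multiIndices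
      (β := fun j n => if j = 0 then b 0 else S.shellTerm (t j) s (x j) (b j) (m j) n) rfl
      fun j hj hjk => by
        simp only [if_neg (by omega : j ≠ 0), S.sum_shellTerm _ _ _ _ (hN j hj hjk)]
  rw [hexpand]
  calc ‖∑ ν ∈ 𝒩, multiComm (fun j => if j = 0 then b 0
          else S.shellTerm (t j) s (x j) (b j) (m j) (ν j)) k‖
      ≤ ∑ ν ∈ 𝒩, 2 ^ k * (∏ j ∈ Finset.range (k + 1), ‖b j‖) *
          ∑ T ∈ trees k, kappa k T ν x * weight ν :=
        norm_sum_le_of_le _ fun ν hν =>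
          norm_multiComm_shellTerm_le hα h0 h (eq_of_mem_multiIndices hν (by simp))
            (fun j hj hjk => (Finset.mem_Icc.1 (mem_of_mem_multiIndices hν hj hjk)).1) t s
    _ = 2 ^ k * (∏ j ∈ Finset.range (k + 1), ‖b j‖) *
          ∑ T ∈ trees k, ∑ ν ∈ 𝒩, kappa k T ν x * weight ν := by
        rw [← Finset.mul_sum, Finset.sum_comm]
    _ ≤ _ := by
        gcongr with T
        exact sum_multiIndices_le_kappa_add_remainder F k T m x α.2 _ N

theorem norm_multiComm_le_of_isInfiniteVolumeDynamics
    (hα : ∀ t, (S.interaction t).normW F ≤ α) {τ : ℝ → ℝ → CAR d →L[ℂ] CAR d}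
    (hτ : IsInfiniteVolumeDynamics S.interaction S.potential τ)
    (h0 : b 0 ∈ closedLocalAlg (boxAt (m 0) (x 0)))
    (h : ∀ j, 1 ≤ j → j ≤ k → b j ∈ evenLocalAlg (boxAt (m j) (x j))) (t : ℕ → ℝ) (s : ℝ) :
    ‖multiComm (fun j => if j = 0 then b 0 else τ (t j) s (b j)) k‖ ≤
      2 ^ k * (∏ j ∈ Finset.range (k + 1), ‖b j‖) *
        ∑ T ∈ trees k, (kappa k T m x + remainder F k T α (fun j => t j - s) m x) := by
  have hlim : Filter.Tendsto (fun N : ℕ => multiComm (fun j => if j = 0 then b 0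
        else S.dynamics (boxAt N (x j)) (t j) s (b j)) k) Filter.atTop
      (nhds (multiComm (fun j => if j = 0 then b 0 else τ (t j) s (b j)) k)) := by
    refine tendsto_multiComm fun j _ => ?_
    split_ifs
    exacts [tendsto_const_nhds, (tendsto_dynamics hα hτ _ _ _).comp (tendsto_boxAt (x j))]
  have hlarge : ∀ᶠ N : ℕ in Filter.atTop, ∀ j ∈ Finset.Icc 1 k, m j ≤ N :=
    (Finset.eventually_all _).2 fun j _ => Filter.eventually_ge_atTop (m j)
  refine le_of_tendsto hlim.norm (hlarge.mono fun N hN => ?_)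
  exact norm_multiComm_dynamics_boxAt_le hα h0 h
    (fun j hj hjk => hN j (Finset.mem_Icc.2 ⟨hj, hjk⟩)) t s

end MultiComm

end FermiSystem

end FermiLattice

theorem mainTheorem3 {d : ℕ} (hd : 0 < d) (F : FermiLattice.DecayFunction d)
    (Ψ : ℝ → FermiLattice.Interaction d) (V : ℝ → FermiLattice.Potential d)
    (hΨ_bdd : FermiLattice.supNormW Ψ F < ⊤)
    (hΨ_cont : ∀ Λ, Continuous fun t => (Ψ t).toFun Λ)
    (hV_cont : ∀ y, Continuous fun t => (V t).toFun y) :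
    (∃ τ, FermiLattice.IsInfiniteVolumeDynamics Ψ V τ) ∧
    ∀ τ, FermiLattice.IsInfiniteVolumeDynamics Ψ V τ →
      ∀ (s : ℝ) (k : ℕ), 1 ≤ k →
      ∀ (m : ℕ → ℕ) (t : ℕ → ℝ) (x : ℕ → FermiLattice.Lattice d) (B : ℕ → FermiLattice.CAR d),
        (∀ j ≤ k, B j ∈ FermiLattice.localAlg (FermiLattice.box (m j))) →
        (∀ j, 1 ≤ j → j ≤ k → FermiLattice.IsEven (B j)) →
        ‖FermiLattice.multiComm
            (fun j => if j = 0 then FermiLattice.translation (x 0) (B 0)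
              else τ (t j) s (FermiLattice.translation (x j) (B j))) k‖ ≤
          2 ^ k * (∏ j ∈ Finset.range (k + 1), ‖B j‖) *
            ∑ T ∈ FermiLattice.trees k, (FermiLattice.kappa k T m x +
              FermiLattice.remainder F k T (FermiLattice.supNormW Ψ F).toReal
                (fun j => t j - s) m x) := by
  open FermiLattice in
  let S : FermiSystem d := ⟨Ψ, V, hΨ_cont, hV_cont⟩
  have hα : ∀ t, (S.interaction t).normW F ≤ (supNormW Ψ F).toNNReal := fun t => by
    rw [ENNReal.coe_toNNReal hΨ_bdd.ne]
    exact le_iSup (fun t => (Ψ t).normW F) t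
  refine ⟨FermiSystem.exists_isInfiniteVolumeDynamics hα, fun τ hτ s k _ m t x B hB hBe => ?_⟩
  have hbound := FermiSystem.norm_multiComm_le_of_isInfiniteVolumeDynamics (S := S) hα hτ (k := k)
    (m := m) (x := x) (b := fun j => translation (x j) (B j))
    (localAlg_le_closedLocalAlg _ (translation_mem_localAlg (x 0) (hB 0 k.zero_le)))
    (fun j hj hjk => translation_mem_evenLocalAlg (x j) (hB j hjk) (hBe j hj hjk)) t s
  simp only [norm_translation] at hbound
  exact hbound
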